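/- **Setting.** Let $M$ be a complete Riemannian manifold (no orientation is needed), and let $G$ be a unimodular locally compact group acting on $M$ properly, cocompactly and by smooth isometries. Fix a Haar measure $dx$ on $G$ and a function $\psi\in C_c^\infty(M)$, $\psi\ge 0$, with $\int_G\psi(xm)\,dx=1$ for all $m\in M$. Let $g\in G$, let $Z$ be its centraliser, and let $d(hZ)$ be a $G$-invariant measure on $G/Z$. Let $E\to M$ be a complex $G$-vector bundle of finite rank with a $G$-invariant flat connection $\nabla^E$, extended to $E$-valued differential forms. For a $G$-invariant Hermitian metric on $E$ that is preserved by $\nabla^E$, let $(\nabla^E)^*$ be the formal adjoint of $\nabla^E$ with respect to the $L^2$-inner products, let $\Delta_E=(\nabla^E)^*\nabla^E+\nabla^E(\nabla^E)^*$, let $\Delta_E^p$ be the (self-adjoint) closure on $L^2(M;\bigwedge^pT^*M\otimes E)$ of its restriction to compactly supported smooth $p$-forms, and let $P_p$ be the orthogonal projection onto the $L^2$-kernel of $\Delta_E^p$. An operator $T$ with a smooth kernel $\kappa$ is *$g$-trace class* if the integral $$\operatorname{Tr}_g(T)=\int_{G/Z}\int_M\psi(hgh^{-1}m)\operatorname{tr}\bigl(hgh^{-1}\kappa(hg^{-1}h^{-1}m,m)\bigr)\,dm\,d(hZ)$$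 converges absolutely. Consider the conditions: 1. for all $t>0$ and all $p$, the operator $e^{-t\Delta_E^p}-P_p$ has a smooth kernel and is $g$-trace class; put $\mathcal T_g(t)=\sum_{p=0}^{\dim M}(-1)^p\,p\operatorname{Tr}_g(e^{-t\Delta_E^p}-P_p)$; 2. $\mathcal T_g(t)=\mathcal O(t^{-\alpha})$ as $t\to\infty$ for some $\alpha>0$; 3. $\frac1{\Gamma(s)}\int_0^1t^{s-1}\mathcal T_g(t)\,dt$ converges for $s\in\mathbb C$ with large enough real part, and has a meromorphic continuation to $\mathbb C$ that is regular at $s=0$. If they hold, the equivariant analytic torsion $T_g(\nabla^E)$ is defined by $$-2\log T_g(\nabla^E)=\left.\frac{d}{ds}\right|_{s=0}\frac1{\Gamma(s)}\int_0^1t^{s-1}\mathcal T_g(t)\,dt+\int_1^\infty t^{-1}\mathcal T_g(t)\,dt .$$ **Statement.** The operators $(\nabla^E)^*$ and $\Delta_E$ on compactly supported smooth $E$-valued forms are the same for all $G$-invariant Hermitian metrics on $E$ that are preserved by $\nabla^E$. If conditions 1–3 hold for one such metric, then they hold for all such metrics, and the number $-2\log T_g(\nabla^E)$, hence also the torsion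 $T_g(\nabla^E)$, is the same for all of them. -/

import Mathlib

set_option linter.unusedSectionVars false

open Bundle MeasureTheory Set Filter Topology
open scoped Manifold ContDiff ComplexConjugate

noncomputable section

namespace EquivariantTorsion

/-! ### Differential forms with values in a complex vector bundle -/

section Forms

variable {n : ℕ} {M : Type*} [TopologicalSpace M] [ChartedSpace (EuclideanSpace ℝ (Fin n)) M]

variable (n) in
/-- The fibre at `m` of the bundle of `p`-forms with values in `E`: alternating `ℝ`-multilinear
maps from `p` tangent vectors at `m` to the complex vector space `E m`. -/
abbrev FormFibre (E : M → Type*) [∀ m, AddCommGroup (E m)] [∀ m, Module ℂ (E m)]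
    (p : ℕ) (m : M) : Type _ :=
  (TangentSpace (𝓡 n) m) [⋀^Fin p]→ₗ[ℝ] (E m)

variable (F : Type*) [NormedAddCommGroup F] [NormedSpace ℂ F]
  {E : M → Type*} [∀ m, AddCommGroup (E m)] [∀ m, Module ℂ (E m)]
  [TopologicalSpace (TotalSpace F E)] [∀ m, TopologicalSpace (E m)] [FiberBundle F E]

variable (n) in
/-- A section of `E` is smooth at `m`. -/
def SmoothSectionAt (s : Π m, E m) (m : M) : Prop :=
  ContMDiffAt (𝓡 n) ((𝓡 n).prod 𝓘(ℝ, F)) ∞ (fun m' ↦ TotalSpace.mk' F m' (s m')) m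

theorem smoothSectionAt_smul [VectorBundle ℂ F E] (c : ℂ) {s : Π m, E m} {m : M}
    (hs : SmoothSectionAt n F s m) : SmoothSectionAt n F (fun m' ↦ c • s m') m := by
  unfold SmoothSectionAt at hs ⊢
  rw [contMDiffAt_section] at hs ⊢
  have h1 : ContMDiffAt (𝓡 n) 𝓘(ℝ, F) ∞
      (fun x ↦ c • (trivializationAt F E m ⟨x, s x⟩).2) m := by
    have hl : ContMDiff 𝓘(ℝ, F) 𝓘(ℝ, F) ∞ (fun y : F ↦ c • y) :=
      (contDiff_const_smul c).contMDiff
    exact hl.contMDiffAt.comp m hs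
  refine h1.congr_of_eventuallyEq ?_
  filter_upwards [(trivializationAt F E m).open_baseSet.mem_nhds
    (FiberBundle.mem_baseSet_trivializationAt F E m)] with x hx
  exact ((trivializationAt F E m).linear ℂ hx).map_smul c (s x)

variable [IsManifold (𝓡 n) ∞ M]

/-- The coordinate vector field with constant coefficients `v` in the chart around `m₀`
(extended by `0` outside the domain of the chart). -/
def coordField (m₀ : M) (v : EuclideanSpace ℝ (Fin n)) (m : M) : TangentSpace (𝓡 n) m :=
  (trivializationAt (EuclideanSpace ℝ (Fin n)) (TangentSpace (𝓡 n) : M → Type _) m₀).symm m v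

theorem coordField_smoothAt (m₀ : M) (v : EuclideanSpace ℝ (Fin n)) {m : M}
    (hm : m ∈ (chartAt (EuclideanSpace ℝ (Fin n)) m₀).source) :
    ContMDiffAt (𝓡 n) ((𝓡 n).prod 𝓘(ℝ, EuclideanSpace ℝ (Fin n))) ∞
      (fun m' ↦ TotalSpace.mk' (EuclideanSpace ℝ (Fin n)) m' (coordField m₀ v m')) m := by
  set e := trivializationAt (EuclideanSpace ℝ (Fin n)) (TangentSpace (𝓡 n) : M → Type _) m₀
    with he
  have hm' : m ∈ e.baseSet := by simpa [he] using hm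
  rw [e.contMDiffAt_section_iff (IB := 𝓡 n) hm']
  refine (contMDiffAt_const (c := v)).congr_of_eventuallyEq ?_
  filter_upwards [e.open_baseSet.mem_nhds hm'] with x hx
  simp only [coordField, ← he]
  rw [e.mk_symm hx, e.apply_symm_apply' hx]

/-- A field of alternating maps is a smooth form: its coefficients with respect to coordinate
vector fields are smooth sections of `E`. -/
def IsSmoothForm {p : ℕ} (α : Π m : M, FormFibre n E p m) : Prop :=
  ∀ (m₀ : M) (v : Fin p → EuclideanSpace ℝ (Fin n)),
    ∀ m ∈ (chartAt (EuclideanSpace ℝ (Fin n)) m₀).source,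
      SmoothSectionAt n F (fun m' ↦ α m' (fun i ↦ coordField m₀ (v i) m')) m

variable [VectorBundle ℝ F E] [VectorBundle ℂ F E]

variable (n E) in
/-- The complex vector space `Ω_c^p(M; E)` of smooth, compactly supported `p`-forms
with values in `E`. -/
def TestForm (p : ℕ) : Submodule ℂ (Π m : M, FormFibre n E p m) where
  carrier := {α | IsSmoothForm F α ∧ ∃ K : Set M, IsCompact K ∧ ∀ m ∉ K, α m = 0}
  zero_mem' := by
    refine ⟨fun m₀ v m _ ↦ ?_, ∅, isCompact_empty, fun m _ ↦ rfl⟩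
    exact contMDiffAt_zeroSection ℝ E
  add_mem' := by
    rintro α β ⟨hα, K, hK, hαK⟩ ⟨hβ, L, hL, hβL⟩
    refine ⟨fun m₀ v m hm ↦ ?_, K ∪ L, hK.union hL, fun m hm ↦ ?_⟩
    · exact ContMDiffAt.add_section (hα m₀ v m hm) (hβ m₀ v m hm)
    · simp only [mem_union, not_or] at hm
      simp [hαK m hm.1, hβL m hm.2]
  smul_mem' := by
    rintro c α ⟨hα, K, hK, hαK⟩
    refine ⟨fun m₀ v m hm ↦ ?_, K, hK, fun m hm ↦ by simp [hαK m hm]⟩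
    exact smoothSectionAt_smul F c (hα m₀ v m hm)

end Forms

/-! ### Riemannian volume -/

section Volume

variable (n : ℕ) {M : Type*} [TopologicalSpace M] [ChartedSpace (EuclideanSpace ℝ (Fin n)) M]
  [IsManifold (𝓡 n) ∞ M] [RiemannianBundle (fun m : M ↦ TangentSpace (𝓡 n) m)]

/-- The Gram matrix `g_{ij}` of the Riemannian metric in the chart around `m₀`. -/
def gram (m₀ m : M) : Matrix (Fin n) (Fin n) ℝ :=
  Matrix.of fun i j ↦ inner ℝ (coordField m₀ (EuclideanSpace.single i 1) m)
    (coordField m₀ (EuclideanSpace.single j 1) m)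

/-- The measure `√(det g) dx¹ ⋯ dxⁿ` on the domain of the chart around `m₀`. -/
def chartVolume [MeasurableSpace M] (m₀ : M) : Measure M :=
  (((volume : Measure (EuclideanSpace ℝ (Fin n))).restrict
      (chartAt (EuclideanSpace ℝ (Fin n)) m₀).target).withDensity
    (fun y ↦ ENNReal.ofReal
      (Real.sqrt (gram n m₀ ((chartAt (EuclideanSpace ℝ (Fin n)) m₀).symm y)).det))).map
    (chartAt (EuclideanSpace ℝ (Fin n)) m₀).symm

variable (M) in
/-- A smooth partition of unity subordinate to the chart domains. -/
def chartPartition [T2Space M] [SigmaCompactSpace M] : SmoothPartitionOfUnity M (𝓡 n) M univ :=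
  (SmoothPartitionOfUnity.exists_isSubordinate_chartAt_source (𝓡 n) M).choose

variable (M) in
/-- The Riemannian volume measure (Riemannian density), obtained by gluing the measures
`√(det g) dx¹ ⋯ dxⁿ` of the charts with a partition of unity. -/
def riemannianVolume [T2Space M] [SigmaCompactSpace M] [MeasurableSpace M] : Measure M :=
  Measure.sum fun m₀ : M ↦
    (chartVolume n m₀).withDensity (fun m ↦ ENNReal.ofReal (chartPartition n M m₀ m))

variable [IsContMDiffRiemannianBundle (𝓡 n) ∞ (EuclideanSpace ℝ (Fin n))
  (fun m : M ↦ TangentSpace (𝓡 n) m)]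

theorem continuousAt_gram (m₀ : M) {m : M}
    (hm : m ∈ (chartAt (EuclideanSpace ℝ (Fin n)) m₀).source) (i j : Fin n) :
    ContinuousAt (fun m' ↦ gram n m₀ m' i j) m :=
  ((coordField_smoothAt m₀ (EuclideanSpace.single i 1) hm).inner_bundle
    (coordField_smoothAt m₀ (EuclideanSpace.single j 1) hm)).continuousAt

theorem chartVolume_lt_top [MeasurableSpace M] [BorelSpace M] [T2Space M] (m₀ : M) {K : Set M}
    (hK : IsCompact K)
    (hKs : K ⊆ (chartAt (EuclideanSpace ℝ (Fin n)) m₀).source) : chartVolume n m₀ K < ⊤ := by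
  set φ := chartAt (EuclideanSpace ℝ (Fin n)) m₀ with hφ
  have hL : IsCompact (φ '' K) := hK.image_of_continuousOn (φ.continuousOn.mono hKs)
  have hLt : φ '' K ⊆ φ.target := by
    rintro _ ⟨x, hx, rfl⟩
    exact φ.map_source (hKs hx)
  have hcont : ContinuousOn (fun y ↦ Real.sqrt (gram n m₀ (φ.symm y)).det) (φ '' K) := by
    intro y hy
    have hyt := hLt hy
    have hs : φ.symm y ∈ φ.source := φ.map_target hyt
    have h1 : ContinuousAt (fun m' ↦ gram n m₀ m') (φ.symm y) :=
      continuousAt_pi.2 fun i ↦ continuousAt_pi.2 fun j ↦ continuousAt_gram n m₀ hs i j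
    have h2 : ContinuousAt (fun m' ↦ Real.sqrt (gram n m₀ m').det) (φ.symm y) :=
      (Real.continuous_sqrt.comp (Continuous.matrix_det continuous_id)).continuousAt.comp h1
    exact (h2.comp (f := φ.symm) (φ.continuousAt_symm hyt)).continuousWithinAt
  obtain ⟨C, hC⟩ := hL.exists_bound_of_continuousOn hcont
  have hms : AEMeasurable φ.symm (((volume : Measure (EuclideanSpace ℝ (Fin n))).restrict
      φ.target).withDensity (fun y ↦ ENNReal.ofReal
      (Real.sqrt (gram n m₀ (φ.symm y)).det))) :=
    (φ.continuousOn_symm.aemeasurable φ.open_target.measurableSet).mono_ac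
      (withDensity_absolutelyContinuous _ _)
  rw [chartVolume, Measure.map_apply_of_aemeasurable hms hK.measurableSet]
  have hpre : (((volume : Measure (EuclideanSpace ℝ (Fin n))).restrict
      φ.target).withDensity (fun y ↦ ENNReal.ofReal
      (Real.sqrt (gram n m₀ (φ.symm y)).det))) (φ.symm ⁻¹' K) ≤
      (((volume : Measure (EuclideanSpace ℝ (Fin n))).restrict
      φ.target).withDensity (fun y ↦ ENNReal.ofReal
      (Real.sqrt (gram n m₀ (φ.symm y)).det))) (φ '' K) := by
    refine measure_mono_ae ?_
    have : ∀ᵐ y ∂((volume : Measure (EuclideanSpace ℝ (Fin n))).restrict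
      φ.target).withDensity (fun y ↦ ENNReal.ofReal
      (Real.sqrt (gram n m₀ (φ.symm y)).det)), y ∈ φ.target :=
      (withDensity_absolutelyContinuous _ _).ae_le (ae_restrict_mem φ.open_target.measurableSet)
    filter_upwards [this] with y hy hyK
    exact ⟨φ.symm y, hyK, φ.right_inv hy⟩
  refine hpre.trans_lt ?_
  rw [withDensity_apply _ hL.measurableSet]
  calc ∫⁻ y in φ '' K, ENNReal.ofReal (Real.sqrt (gram n m₀ (φ.symm y)).det)
        ∂((volume : Measure (EuclideanSpace ℝ (Fin n))).restrict φ.target)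
      ≤ ∫⁻ _ in φ '' K, ENNReal.ofReal C
        ∂((volume : Measure (EuclideanSpace ℝ (Fin n))).restrict φ.target) := by
        refine setLIntegral_mono' hL.measurableSet fun y hy ↦ ENNReal.ofReal_le_ofReal ?_
        exact (le_abs_self _).trans (hC y hy)
    _ < ⊤ := by
        rw [setLIntegral_const]
        refine ENNReal.mul_lt_top ENNReal.ofReal_lt_top ?_
        exact (Measure.restrict_apply_le _ _).trans_lt hL.measure_lt_top

instance instFiniteOnCompacts [T2Space M] [SigmaCompactSpace M] [MeasurableSpace M]
    [BorelSpace M] : IsFiniteMeasureOnCompacts (riemannianVolume n M) where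
  lt_top_of_isCompact := by
    intro K hK
    have hsub : ∀ m₀ : M, tsupport (chartPartition n M m₀) ⊆
        (chartAt (EuclideanSpace ℝ (Fin n)) m₀).source :=
      (SmoothPartitionOfUnity.exists_isSubordinate_chartAt_source (𝓡 n) M).choose_spec
    have hfin : {m₀ : M | (Function.support (chartPartition n M m₀) ∩ K).Nonempty}.Finite :=
      (chartPartition n M).locallyFinite'.finite_nonempty_inter_compact hK
    have hle : ∀ m₀ : M, (chartVolume n m₀).withDensity
        (fun m ↦ ENNReal.ofReal (chartPartition n M m₀ m)) K < ⊤ := by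
      intro m₀
      rw [withDensity_apply _ hK.measurableSet]
      calc ∫⁻ m in K, ENNReal.ofReal (chartPartition n M m₀ m) ∂(chartVolume n m₀)
          ≤ ∫⁻ m in K, (tsupport (chartPartition n M m₀)).indicator 1 m
              ∂(chartVolume n m₀) := by
            refine lintegral_mono fun m ↦ ?_
            by_cases hm : m ∈ tsupport (chartPartition n M m₀)
            · rw [indicator_of_mem hm]
              exact ENNReal.ofReal_le_one.2 ((chartPartition n M).le_one m₀ m)
            · simp [image_eq_zero_of_notMem_tsupport hm]
        _ = chartVolume n m₀ (tsupport (chartPartition n M m₀) ∩ K) := by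
            rw [lintegral_indicator_one (isClosed_tsupport _).measurableSet,
              Measure.restrict_apply (isClosed_tsupport _).measurableSet]
        _ < ⊤ := chartVolume_lt_top n m₀ (hK.inter_left (isClosed_tsupport _))
            (inter_subset_left.trans (hsub m₀))
    rw [riemannianVolume, Measure.sum_apply _ hK.measurableSet,
      tsum_eq_sum (s := hfin.toFinset)]
    · exact ENNReal.sum_lt_top.2 fun m₀ _ ↦ hle m₀
    · intro m₀ hm₀
      rw [withDensity_apply _ hK.measurableSet, setLIntegral_eq_zero hK.measurableSet]
      intro m hm
      have : m ∉ Function.support (chartPartition n M m₀) := by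
        intro h
        exact hm₀ (hfin.mem_toFinset.2 ⟨m, h, hm⟩)
      simp [Function.notMem_support.1 this]

end Volume

theorem sum_orthonormal {V W : Type*} [NormedAddCommGroup V] [InnerProductSpace ℝ V]
    [AddCommGroup W] [Module ℂ W] {ι κ : Type*} [Fintype ι] [Fintype κ] [DecidableEq κ]
    (o : OrthonormalBasis ι ℝ V) (e : Module.Basis κ ℝ V) (B : W →ₗ⋆[ℂ] W →ₗ[ℂ] ℂ) {p : ℕ}
    (α β : V [⋀^Fin p]→ₗ[ℝ] W) :
    IsUnit (Matrix.of fun i j ↦ inner ℝ (e i) (e j) : Matrix κ κ ℝ).det ∧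
    ∑ I : Fin p → ι, B (α fun k ↦ o (I k)) (β fun k ↦ o (I k)) =
      ∑ J : Fin p → κ, ∑ K : Fin p → κ,
        ((∏ k, (Matrix.of fun i j ↦ inner ℝ (e i) (e j) : Matrix κ κ ℝ)⁻¹ (J k) (K k) : ℝ) : ℂ) *
          B (α fun k ↦ e (J k)) (β fun k ↦ e (K k)) := by
  classical
  set G : Matrix κ κ ℝ := Matrix.of fun i j ↦ inner ℝ (e i) (e j) with hG
  set C : Matrix ι κ ℝ := Matrix.of fun i j ↦ e.repr (o i) j with hC
  have hoe : ∀ i, o i = ∑ j, C i j • e j := fun i ↦ (e.sum_repr (o i)).symm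
  have hin : ∀ i k, inner ℝ (o i) (e k) = ∑ l, C i l * G l k := by
    intro i k
    rw [hoe i, sum_inner]
    simp [hG, real_inner_smul_left]
  have h1 : C.transpose * C * G = 1 := by
    ext j k
    have h2 : e.repr (e k) j = ∑ i, inner ℝ (o i) (e k) * C i j := by
      conv_lhs => rw [← o.sum_repr' (e k)]
      simp [hC]
    rw [Matrix.mul_assoc, Matrix.mul_apply]
    simp only [Matrix.mul_apply, Matrix.transpose_apply, ← hin]
    rw [Matrix.one_apply, Finset.sum_congr rfl (fun i _ ↦ mul_comm _ _), ← h2]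
    simp [Finsupp.single_apply, eq_comm]
  have hinv : G⁻¹ = C.transpose * C := Matrix.inv_eq_left_inv h1
  refine ⟨(Matrix.isUnit_iff_isUnit_det G).1 (IsUnit.of_mul_eq_one_right _ h1), ?_⟩
  have hexp : ∀ (γ : V [⋀^Fin p]→ₗ[ℝ] W) (I : Fin p → ι),
      γ (fun k ↦ o (I k)) = ∑ J : Fin p → κ, ((∏ k, C (I k) (J k) : ℝ) : ℂ) • γ fun k ↦ e (J k) := by
    intro γ I
    simp only [hoe]
    have := γ.toMultilinearMap.map_sum (fun k j ↦ C (I k) j • e j)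
    simp only [AlternatingMap.coe_multilinearMap] at this
    rw [this]
    refine Finset.sum_congr rfl fun J _ ↦ ?_
    rw [AlternatingMap.map_smul_univ, Complex.coe_smul]
  have hI : ∀ I : Fin p → ι, B (α fun k ↦ o (I k)) (β fun k ↦ o (I k)) =
      ∑ J : Fin p → κ, ∑ K : Fin p → κ, ((∏ k, C (I k) (J k) * C (I k) (K k) : ℝ) : ℂ) *
        B (α fun k ↦ e (J k)) (β fun k ↦ e (K k)) := by
    intro I
    rw [hexp α I, hexp β I, map_sum B, LinearMap.sum_apply]
    refine Finset.sum_congr rfl fun J _ ↦ ?_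
    rw [map_sum]
    refine Finset.sum_congr rfl fun K _ ↦ ?_
    rw [map_smul, LinearMap.map_smulₛₗ B, LinearMap.smul_apply, Complex.conj_ofReal, smul_eq_mul,
      smul_eq_mul, ← mul_assoc, ← Complex.ofReal_mul, Finset.prod_mul_distrib,
      mul_comm (∏ k, C (I k) (K k))]
  simp_rw [hI]
  rw [Finset.sum_comm]
  refine Finset.sum_congr rfl fun J _ ↦ ?_
  rw [Finset.sum_comm]
  refine Finset.sum_congr rfl fun K _ ↦ ?_
  rw [← Finset.sum_mul, ← Complex.ofReal_sum, hinv]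
  congr 2
  simp only [Matrix.mul_apply, Matrix.transpose_apply]
  rw [Finset.prod_univ_sum]
  simp

/-! ### Hermitian metrics, flat connections and group actions on the bundle -/

section Bundles

variable (n : ℕ) {M : Type*} [TopologicalSpace M] [ChartedSpace (EuclideanSpace ℝ (Fin n)) M]
  (F : Type*) [NormedAddCommGroup F] [NormedSpace ℂ F]
  (E : M → Type*) [∀ m, AddCommGroup (E m)] [∀ m, Module ℂ (E m)]
  [TopologicalSpace (TotalSpace F E)] [∀ m, TopologicalSpace (E m)]
  [FiberBundle F E]

/-- A smooth Hermitian metric on the complex vector bundle `E`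
(conjugate-linear in the first variable). -/
structure HermitianMetric where
  /-- the sesquilinear form on the fibre over `m` -/
  form (m : M) : E m →ₗ⋆[ℂ] E m →ₗ[ℂ] ℂ
  conj_symm : ∀ m v w, conj (form m v w) = form m w v
  pos : ∀ m v, v ≠ 0 → 0 < (form m v v).re
  smooth : ∀ (s t : Π m, E m) (m : M), SmoothSectionAt n F s m → SmoothSectionAt n F t m →
    ContMDiffAt (𝓡 n) 𝓘(ℝ, ℂ) ∞ (fun m' ↦ form m' (s m') (t m')) m

/-- The structure of a `G`-vector bundle on `E`: a lift of the action of `G` on `M` to a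
continuous action of `G` on the total space of `E` by smooth maps, linear on the fibres. -/
structure BundleAction (G : Type*) [Group G] [TopologicalSpace G] [MulAction G M] where
  /-- the action of `x` as a map from the fibre over `m` to the fibre over `x • m` -/
  act (x : G) (m : M) : E m ≃ₗ[ℂ] E (x • m)
  one_act : ∀ m v, TotalSpace.mk' F ((1 : G) • m) (act 1 m v) = TotalSpace.mk' F m v
  mul_act : ∀ x y m v, TotalSpace.mk' F ((x * y) • m) (act (x * y) m v) =
    TotalSpace.mk' F (x • y • m) (act x (y • m) (act y m v))
  continuous : Continuous fun q : G × TotalSpace F E ↦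
    TotalSpace.mk' F (q.1 • q.2.proj) (act q.1 q.2.proj q.2.snd)
  smooth : ∀ x : G, ContMDiff ((𝓡 n).prod 𝓘(ℝ, F)) ((𝓡 n).prod 𝓘(ℝ, F)) ∞
    fun q : TotalSpace F E ↦ TotalSpace.mk' F (x • q.proj) (act x q.proj q.snd)

variable [IsManifold (𝓡 n) ∞ M] [∀ m, IsTopologicalAddGroup (E m)]
  [∀ m, ContinuousSMul ℝ (E m)] [VectorBundle ℝ F E]

/-- A smooth flat complex-linear connection on `E`; here `cov s m v` is `(∇_v s)(m)`. -/
structure FlatConnection where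
  /-- the covariant derivative -/
  cov : CovariantDerivative (𝓡 n) F E
  smooth : CovariantDerivative.ContMDiffCovariantDerivative cov ∞
  map_smul : ∀ (c : ℂ) (s : Π m, E m) (m : M), SmoothSectionAt n F s m →
    ∀ v : TangentSpace (𝓡 n) m, cov (c • s) m v = c • cov s m v
  flat : ∀ (X Y : Π m : M, TangentSpace (𝓡 n) m) (s : Π m, E m),
    ContMDiff (𝓡 n) ((𝓡 n).prod 𝓘(ℝ, EuclideanSpace ℝ (Fin n))) ∞
      (fun m ↦ TotalSpace.mk' (EuclideanSpace ℝ (Fin n)) m (X m)) →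
    ContMDiff (𝓡 n) ((𝓡 n).prod 𝓘(ℝ, EuclideanSpace ℝ (Fin n))) ∞
      (fun m ↦ TotalSpace.mk' (EuclideanSpace ℝ (Fin n)) m (Y m)) →
    (∀ m, SmoothSectionAt n F s m) →
    ∀ m, cov (fun m' ↦ cov s m' (Y m')) m (X m) - cov (fun m' ↦ cov s m' (X m')) m (Y m)
      = cov s m (VectorField.mlieBracket (𝓡 n) X Y m)

variable {n F E}

/-- The connection preserves the Hermitian metric:
`d (s, t) = (∇ s, t) + (s, ∇ t)` for all sections `s`, `t`. -/
def HermitianMetric.IsPreservedBy (h : HermitianMetric n F E) (conn : FlatConnection n F E) :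
    Prop :=
  ∀ (s t : Π m, E m) (m : M), SmoothSectionAt n F s m → SmoothSectionAt n F t m →
    ∀ v : TangentSpace (𝓡 n) m,
      mvfderiv (𝓡 n) (fun m' ↦ h.form m' (s m') (t m')) m v =
        h.form m (conn.cov s m v) (t m) + h.form m (s m) (conn.cov t m v)

/-- `β = ∇ α` for the exterior covariant derivative on `E`-valued forms. Coordinate vector fields
commute, so the invariant formula for the exterior derivative reads
`(∇ α)(v₀, …, v_p) = ∑ i, (-1)^i ∇_{v_i} (α(v₀, …, v̂_i, …, v_p))`
with the tangent vectors `v_j` at `m` extended to coordinate vector fields of the chart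
around `m`. -/
def IsExtDeriv (conn : FlatConnection n F E) {p : ℕ} (α : Π m : M, FormFibre n E p m)
    (β : Π m : M, FormFibre n E (p + 1) m) : Prop :=
  ∀ (m : M) (v : Fin (p + 1) → EuclideanSpace ℝ (Fin n)),
    β m (fun i ↦ coordField m (v i) m) = ∑ i : Fin (p + 1), (-1 : ℝ) ^ (i : ℕ) •
      conn.cov (fun m' ↦ α m' (fun j ↦ coordField m (v (i.succAbove j)) m')) m
        (coordField m (v i) m)

variable {G : Type*} [Group G] [TopologicalSpace G] [MulAction G M]

/-- The Hermitian metric is `G`-invariant. -/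
def HermitianMetric.IsInvariant (h : HermitianMetric n F E) (ρ : BundleAction n F E G) : Prop :=
  ∀ (x : G) (m : M) (v w : E m), h.form (x • m) (ρ.act x m v) (ρ.act x m w) = h.form m v w

/-- The connection is `G`-invariant: it commutes with the action of `G` on sections,
`∇_v (x⁻¹ · s) = x⁻¹ · (∇_{dx(v)} s)`, where `(x⁻¹ · s)(m) = x⁻¹ (s (x m))`. -/
def FlatConnection.IsInvariant (conn : FlatConnection n F E) (ρ : BundleAction n F E G) : Prop :=
  ∀ (x : G) (s : Π m, E m) (m : M), SmoothSectionAt n F s (x • m) →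
    ∀ v : TangentSpace (𝓡 n) m,
      conn.cov (fun m' ↦ (ρ.act x m').symm (s (x • m'))) m v =
        (ρ.act x m).symm (conn.cov s (x • m) (mfderiv (𝓡 n) (𝓡 n) (fun m' : M ↦ x • m') m v))

end Bundles

/-! ### Square-integrable forms and the Laplacian -/

section L2

variable {n : ℕ} {M : Type*} [TopologicalSpace M] [ChartedSpace (EuclideanSpace ℝ (Fin n)) M]
  [IsManifold (𝓡 n) ∞ M] [RiemannianBundle (fun m : M ↦ TangentSpace (𝓡 n) m)]
  {F : Type*} [NormedAddCommGroup F] [NormedSpace ℂ F]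
  {E : M → Type*} [∀ m, AddCommGroup (E m)] [∀ m, Module ℂ (E m)]
  [TopologicalSpace (TotalSpace F E)] [∀ m, TopologicalSpace (E m)]
  [FiberBundle F E]

instance (m : M) : FiniteDimensional ℝ (TangentSpace (𝓡 n) m) :=
  inferInstanceAs (FiniteDimensional ℝ (EuclideanSpace ℝ (Fin n)))

/-- The inner product on `E`-valued `p`-covectors at `m` induced by the Riemannian metric and the
Hermitian metric: the sum of `(α(b_{i₁}, …, b_{i_p}), β(b_{i₁}, …, b_{i_p}))` over
`i₁ < ⋯ < i_p`, for an orthonormal basis `b` of the tangent space. (Every summand is counted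
`p!` times below, and divided by `p!`.) -/
def HermitianMetric.formInner (h : HermitianMetric n F E) {p : ℕ} (m : M)
    (α β : FormFibre n E p m) : ℂ :=
  (p.factorial : ℂ)⁻¹ * ∑ I : Fin p → Fin (Module.finrank ℝ (TangentSpace (𝓡 n) m)),
    h.form m (α (fun k ↦ stdOrthonormalBasis ℝ (TangentSpace (𝓡 n) m) (I k)))
      (β (fun k ↦ stdOrthonormalBasis ℝ (TangentSpace (𝓡 n) m) (I k)))

theorem continuous_formInner [IsContMDiffRiemannianBundle (𝓡 n) ∞ (EuclideanSpace ℝ (Fin n))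
    (fun m : M ↦ TangentSpace (𝓡 n) m)] (h : HermitianMetric n F E) {p : ℕ}
    {α β : Π m : M, FormFibre n E p m} (hα : IsSmoothForm F α) (hβ : IsSmoothForm F β) :
    Continuous fun m ↦ h.formInner m (α m) (β m) := by
  rw [continuous_iff_continuousAt]
  intro m₀
  set e := trivializationAt (EuclideanSpace ℝ (Fin n)) (TangentSpace (𝓡 n) : M → Type _) m₀
    with he
  set b := (EuclideanSpace.basisFun (Fin n) ℝ).toBasis
  have hm₀ : m₀ ∈ (chartAt (EuclideanSpace ℝ (Fin n)) m₀).source := mem_chart_source _ m₀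
  have hm₀' : m₀ ∈ e.baseSet := by simp [he]
  have hb : ∀ (m : M) (hm : m ∈ e.baseSet) (i : Fin n),
      e.basisAt b hm i = coordField m₀ (EuclideanSpace.single i 1) m := by
    intro m hm i
    simp [Trivialization.basisAt, b, coordField, he]
  have key : ∀ (m : M), m ∈ e.baseSet → IsUnit (gram n m₀ m).det ∧
      h.formInner m (α m) (β m) = (p.factorial : ℂ)⁻¹ * ∑ J : Fin p → Fin n,
        ∑ K : Fin p → Fin n, ((∏ k, (gram n m₀ m)⁻¹ (J k) (K k) : ℝ) : ℂ) *
        h.form m (α m fun k ↦ coordField m₀ (EuclideanSpace.single (J k) 1) m)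
          (β m fun k ↦ coordField m₀ (EuclideanSpace.single (K k) 1) m) := by
    intro m hm
    have := sum_orthonormal (stdOrthonormalBasis ℝ (TangentSpace (𝓡 n) m)) (e.basisAt b hm)
      (h.form m) (α m) (β m)
    simp only [hb] at this
    exact ⟨this.1, by rw [HermitianMetric.formInner, this.2]; rfl⟩
  have hG : ContinuousAt (fun m ↦ gram n m₀ m) m₀ :=
    continuousAt_pi.2 fun i ↦ continuousAt_pi.2 fun j ↦ continuousAt_gram n m₀ hm₀ i j
  have hGinv : ∀ i j, ContinuousAt (fun m ↦ (gram n m₀ m)⁻¹ i j) m₀ := by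
    intro i j
    simp only [Matrix.inv_def, Ring.inverse_eq_inv', Matrix.smul_apply, smul_eq_mul]
    refine ContinuousAt.mul (ContinuousAt.inv₀ ?_ (key m₀ hm₀').1.ne_zero) ?_
    · exact (Continuous.matrix_det continuous_id).continuousAt.comp hG
    · have h1 : ContinuousAt (fun m ↦ (gram n m₀ m).adjugate) m₀ :=
        (Continuous.matrix_adjugate continuous_id).continuousAt.comp hG
      exact continuousAt_pi.1 (continuousAt_pi.1 h1 i) j
  refine ContinuousAt.congr (f := fun m ↦ (p.factorial : ℂ)⁻¹ * ∑ J : Fin p → Fin n,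
        ∑ K : Fin p → Fin n, ((∏ k, (gram n m₀ m)⁻¹ (J k) (K k) : ℝ) : ℂ) *
        h.form m (α m fun k ↦ coordField m₀ (EuclideanSpace.single (J k) 1) m)
          (β m fun k ↦ coordField m₀ (EuclideanSpace.single (K k) 1) m)) ?_ ?_
  · refine continuousAt_const.mul (tendsto_finsetSum _ fun J _ ↦ tendsto_finsetSum _ fun K _ ↦
      ContinuousAt.mul ?_ ?_)
    · exact Complex.continuous_ofReal.continuousAt.comp
        (tendsto_finsetProd _ fun k _ ↦ hGinv (J k) (K k))
    · exact (h.smooth _ _ m₀ (hα m₀ _ m₀ hm₀) (hβ m₀ _ m₀ hm₀)).continuousAt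
  · filter_upwards [e.open_baseSet.mem_nhds hm₀'] with m hm
    exact (key m hm).2.symm

theorem formInner_conj_symm (h : HermitianMetric n F E) {p : ℕ} (m : M)
    (α β : FormFibre n E p m) : conj (h.formInner m β α) = h.formInner m α β := by
  simp [HermitianMetric.formInner, h.conj_symm]

theorem formInner_add_left (h : HermitianMetric n F E) {p : ℕ} (m : M)
    (α β γ : FormFibre n E p m) :
    h.formInner m (α + β) γ = h.formInner m α γ + h.formInner m β γ := by
  simp [HermitianMetric.formInner, Finset.sum_add_distrib, mul_add]

theorem formInner_smul_left (h : HermitianMetric n F E) {p : ℕ} (m : M) (c : ℂ)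
    (α β : FormFibre n E p m) : h.formInner m (c • α) β = conj c * h.formInner m α β := by
  simp only [HermitianMetric.formInner, AlternatingMap.smul_apply, LinearMap.map_smulₛₗ,
    LinearMap.smul_apply, smul_eq_mul, ← Finset.mul_sum]
  ring

theorem formInner_self_nonneg (h : HermitianMetric n F E) {p : ℕ} (m : M)
    (α : FormFibre n E p m) : 0 ≤ (h.formInner m α α).re := by
  have h0 : ∀ v, 0 ≤ (h.form m v v).re := by
    intro v
    rcases eq_or_ne v 0 with rfl | hv
    · simp
    · exact (h.pos m v hv).le
  have h1 : ((p.factorial : ℂ)⁻¹) = ((p.factorial : ℝ)⁻¹ : ℝ) := by simp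
  rw [HermitianMetric.formInner, h1, Complex.re_ofReal_mul, Complex.re_sum]
  exact mul_nonneg (by positivity) (Finset.sum_nonneg fun I _ ↦ h0 _)

variable [VectorBundle ℝ F E] [VectorBundle ℂ F E]
  [T2Space M] [SigmaCompactSpace M] [MeasurableSpace M]

/-- The `L²`-inner product of compactly supported smooth `E`-valued forms. -/
def HermitianMetric.l2Inner (h : HermitianMetric n F E) {p : ℕ} (α β : TestForm n F E p) : ℂ :=
  ∫ m, h.formInner m (α.1 m) (β.1 m) ∂(riemannianVolume n M)

variable [BorelSpace M] [IsContMDiffRiemannianBundle (𝓡 n) ∞ (EuclideanSpace ℝ (Fin n))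
  (fun m : M ↦ TangentSpace (𝓡 n) m)]

theorem integrable_formInner (h : HermitianMetric n F E) {p : ℕ} (α β : TestForm n F E p) :
    Integrable (fun m ↦ h.formInner m (α.1 m) (β.1 m)) (riemannianVolume n M) := by
  refine (continuous_formInner h α.2.1 β.2.1).integrable_of_hasCompactSupport ?_
  obtain ⟨K, hK, hαK⟩ := α.2.2
  refine HasCompactSupport.intro hK fun m hm ↦ ?_
  rw [hαK m hm]
  simp [HermitianMetric.formInner]

variable (h : HermitianMetric n F E) (p : ℕ)

/-- The space of compactly supported smooth `E`-valued `p`-forms, with the `L²`-inner product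
defined by the Riemannian metric and the Hermitian metric `h`. -/
def PreL2 (_h : HermitianMetric n F E) (p : ℕ) : Type _ := TestForm n F E p

instance : AddCommGroup (PreL2 h p) := inferInstanceAs (AddCommGroup (TestForm n F E p))

instance : Module ℂ (PreL2 h p) := inferInstanceAs (Module ℂ (TestForm n F E p))

theorem l2Inner_add_left (α β γ : TestForm n F E p) :
    h.l2Inner (α + β) γ = h.l2Inner α γ + h.l2Inner β γ := by
  unfold HermitianMetric.l2Inner
  rw [← integral_add (integrable_formInner h α γ) (integrable_formInner h β γ)]
  exact integral_congr_ae (Eventually.of_forall fun m ↦ formInner_add_left h m _ _ _)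

theorem l2Inner_smul_left (c : ℂ) (α β : TestForm n F E p) :
    h.l2Inner (c • α) β = conj c * h.l2Inner α β := by
  unfold HermitianMetric.l2Inner
  rw [← integral_const_mul]
  exact integral_congr_ae (Eventually.of_forall fun m ↦ formInner_smul_left h m _ _ _)

instance instCore : PreInnerProductSpace.Core ℂ (PreL2 h p) where
  inner := h.l2Inner (p := p)
  conj_inner_symm α β := by
    refine (integral_conj (𝕜 := ℂ)).symm.trans ?_
    exact integral_congr_ae (Eventually.of_forall fun m ↦ formInner_conj_symm h m _ _)
  re_inner_nonneg α := by
    have h1 := integral_re (𝕜 := ℂ) (integrable_formInner h (p := p) α α)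
    refine le_of_le_of_eq ?_ h1
    exact integral_nonneg fun m ↦ formInner_self_nonneg h m _
  add_left := l2Inner_add_left h p
  smul_left α β c := l2Inner_smul_left h p c α β

instance : SeminormedAddCommGroup (PreL2 h p) :=
  InnerProductSpace.Core.toSeminormedAddCommGroup (𝕜 := ℂ)

instance : InnerProductSpace ℂ (PreL2 h p) := InnerProductSpace.ofCore (instCore h p)

/-- The Hilbert space of square-integrable `E`-valued `p`-forms: the completion of the compactly
supported smooth forms in the `L²`-inner product. -/
abbrev L2Form : Type _ := UniformSpace.Completion (PreL2 h p)

/-- The inclusion of the compactly supported smooth forms into the square-integrable forms. -/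
def toL2 : TestForm n F E p →ₗ[ℂ] L2Form h p :=
  (UniformSpace.Completion.toComplL (𝕜 := ℂ) (E := PreL2 h p)).toLinearMap

end L2

/-! ### The Laplacian, its kernel and the heat operators -/

section Laplacian

variable {n : ℕ} {M : Type*} [TopologicalSpace M] [ChartedSpace (EuclideanSpace ℝ (Fin n)) M]
  [IsManifold (𝓡 n) ∞ M] [RiemannianBundle (fun m : M ↦ TangentSpace (𝓡 n) m)]
  {F : Type*} [NormedAddCommGroup F] [NormedSpace ℂ F]
  {E : M → Type*} [∀ m, AddCommGroup (E m)] [∀ m, Module ℂ (E m)]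
  [TopologicalSpace (TotalSpace F E)] [∀ m, TopologicalSpace (E m)]
  [FiberBundle F E] [∀ m, IsTopologicalAddGroup (E m)] [∀ m, ContinuousSMul ℝ (E m)]
  [VectorBundle ℝ F E] [VectorBundle ℂ F E]
  [T2Space M] [SigmaCompactSpace M] [MeasurableSpace M]

/-- `γ = ∇* β` for the formal adjoint `∇*` of `∇` with respect to the `L²`-inner products. -/
def IsFormalAdjoint (h : HermitianMetric n F E) (conn : FlatConnection n F E) {p : ℕ}
    (β : TestForm n F E (p + 1)) (γ : TestForm n F E p) : Prop :=
  ∀ (α : TestForm n F E p) (α' : TestForm n F E (p + 1)), IsExtDeriv conn α.1 α'.1 →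
    h.l2Inner γ α = h.l2Inner β α'

/-- `χ = Δ α` for the Laplacian `Δ = ∇* ∇ + ∇ ∇*` on `E`-valued `p`-forms. -/
def IsLaplacian (h : HermitianMetric n F E) (conn : FlatConnection n F E) :
    (p : ℕ) → TestForm n F E p → TestForm n F E p → Prop
  | 0, α, χ => ∃ η : TestForm n F E 1, IsExtDeriv conn α.1 η.1 ∧ IsFormalAdjoint h conn η χ
  | p + 1, α, χ => ∃ (η : TestForm n F E (p + 2)) (θ : TestForm n F E p)
      (χ₁ χ₂ : TestForm n F E (p + 1)),
      IsExtDeriv conn α.1 η.1 ∧ IsFormalAdjoint h conn η χ₁ ∧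
      IsFormalAdjoint h conn α θ ∧ IsExtDeriv conn θ.1 χ₂.1 ∧ χ = χ₁ + χ₂

theorem mdifferentiableAt_coeff {p : ℕ} (α : TestForm n F E p) (m : M)
    (v : Fin p → EuclideanSpace ℝ (Fin n)) :
    SmoothSectionAt n F (fun m' ↦ α.1 m' (fun i ↦ coordField m (v i) m')) m :=
  α.2.1 m v m (mem_chart_source _ m)

theorem isExtDeriv_zero (conn : FlatConnection n F E) (p : ℕ) :
    IsExtDeriv conn (0 : TestForm n F E p).1 (0 : TestForm n F E (p + 1)).1 := by
  intro m v
  symm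
  refine Finset.sum_eq_zero fun i _ ↦ ?_
  have h0 := conn.cov.isCovariantDerivativeOn.zero (x := m) (mem_univ m)
  have : conn.cov (fun m' : M ↦ (0 : TestForm n F E p).1 m'
      (fun j ↦ coordField m (v (i.succAbove j)) m')) m = 0 := h0
  rw [this]
  simp

theorem IsExtDeriv.add {conn : FlatConnection n F E} {p : ℕ} {α β : TestForm n F E p}
    {α' β' : TestForm n F E (p + 1)} (hα : IsExtDeriv conn α.1 α'.1)
    (hβ : IsExtDeriv conn β.1 β'.1) : IsExtDeriv conn (α + β).1 (α' + β').1 := by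
  intro m v
  have h1 := hα m v
  have h2 := hβ m v
  change α'.1 m _ + β'.1 m _ = _
  rw [h1, h2, ← Finset.sum_add_distrib]
  refine Finset.sum_congr rfl fun i _ ↦ ?_
  have h3 := conn.cov.isCovariantDerivativeOn.add (x := m)
    ((mdifferentiableAt_coeff α m fun j ↦ v (i.succAbove j)).mdifferentiableAt (by simp))
    ((mdifferentiableAt_coeff β m fun j ↦ v (i.succAbove j)).mdifferentiableAt (by simp))
    (mem_univ m)
  have h4 : conn.cov (fun m' : M ↦ (α + β).1 m'
      (fun j ↦ coordField m (v (i.succAbove j)) m')) m = _ := h3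
  rw [h4, add_apply, smul_add]

theorem IsExtDeriv.smul {conn : FlatConnection n F E} {p : ℕ} (c : ℂ) {α : TestForm n F E p}
    {α' : TestForm n F E (p + 1)} (hα : IsExtDeriv conn α.1 α'.1) :
    IsExtDeriv conn (c • α).1 (c • α').1 := by
  intro m v
  have h1 := hα m v
  change c • α'.1 m _ = _
  rw [h1, Finset.smul_sum]
  refine Finset.sum_congr rfl fun i _ ↦ ?_
  have h3 := conn.map_smul c _ m (mdifferentiableAt_coeff α m fun j ↦ v (i.succAbove j))
    (coordField m (v i) m)
  have h4 : conn.cov (fun m' : M ↦ (c • α).1 m'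
      (fun j ↦ coordField m (v (i.succAbove j)) m')) m (coordField m (v i) m) = _ := h3
  rw [h4, smul_comm]

variable [BorelSpace M] [IsContMDiffRiemannianBundle (𝓡 n) ∞ (EuclideanSpace ℝ (Fin n))
  (fun m : M ↦ TangentSpace (𝓡 n) m)]

theorem IsFormalAdjoint.add {h : HermitianMetric n F E} {conn : FlatConnection n F E} {p : ℕ}
    {α β : TestForm n F E (p + 1)} {α' β' : TestForm n F E p} (hα : IsFormalAdjoint h conn α α')
    (hβ : IsFormalAdjoint h conn β β') : IsFormalAdjoint h conn (α + β) (α' + β') := by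
  intro γ γ' hγ
  rw [l2Inner_add_left, l2Inner_add_left, hα γ γ' hγ, hβ γ γ' hγ]

theorem IsFormalAdjoint.smul {h : HermitianMetric n F E} {conn : FlatConnection n F E} {p : ℕ}
    (c : ℂ) {α : TestForm n F E (p + 1)} {α' : TestForm n F E p}
    (hα : IsFormalAdjoint h conn α α') : IsFormalAdjoint h conn (c • α) (c • α') := by
  intro γ γ' hγ
  rw [l2Inner_smul_left, l2Inner_smul_left, hα γ γ' hγ]

theorem isFormalAdjoint_zero (h : HermitianMetric n F E) (conn : FlatConnection n F E) (p : ℕ) :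
    IsFormalAdjoint h conn (0 : TestForm n F E (p + 1)) 0 := by
  intro γ γ' _
  have h1 := l2Inner_smul_left h p 0 0 γ
  have h2 := l2Inner_smul_left h (p + 1) 0 0 γ'
  simp only [smul_zero, map_zero, zero_mul] at h1 h2
  rw [h1, h2]

variable (h : HermitianMetric n F E) (conn : FlatConnection n F E) (p : ℕ)

/-- The graph of the Laplacian on compactly supported smooth `p`-forms. -/
def laplacianGraph : Submodule ℂ (TestForm n F E p × TestForm n F E p) where
  carrier := {q | IsLaplacian h conn p q.1 q.2}
  zero_mem' := by
    cases p with
    | zero => exact ⟨0, isExtDeriv_zero conn 0, isFormalAdjoint_zero h conn 0⟩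
    | succ p =>
      exact ⟨0, 0, 0, 0, isExtDeriv_zero conn (p + 1), isFormalAdjoint_zero h conn (p + 1),
        isFormalAdjoint_zero h conn p, isExtDeriv_zero conn p, (add_zero 0).symm⟩
  add_mem' := by
    rintro ⟨α, χ⟩ ⟨α', χ'⟩ hα hα'
    cases p with
    | zero =>
      obtain ⟨η, h1, h2⟩ := hα
      obtain ⟨η', h1', h2'⟩ := hα'
      exact ⟨η + η', h1.add h1', h2.add h2'⟩
    | succ p =>
      obtain ⟨η, θ, χ₁, χ₂, h1, h2, h3, h4, h5⟩ := hα
      obtain ⟨η', θ', χ₁', χ₂', h1', h2', h3', h4', h5'⟩ := hα'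
      refine ⟨η + η', θ + θ', χ₁ + χ₁', χ₂ + χ₂', h1.add h1', h2.add h2', h3.add h3',
        h4.add h4', ?_⟩
      change χ + χ' = _
      rw [show χ = χ₁ + χ₂ from h5, show χ' = χ₁' + χ₂' from h5', add_add_add_comm]
  smul_mem' := by
    rintro c ⟨α, χ⟩ hα
    cases p with
    | zero =>
      obtain ⟨η, h1, h2⟩ := hα
      exact ⟨c • η, h1.smul c, h2.smul c⟩
    | succ p =>
      obtain ⟨η, θ, χ₁, χ₂, h1, h2, h3, h4, h5⟩ := hα
      refine ⟨c • η, c • θ, c • χ₁, c • χ₂, h1.smul c, h2.smul c, h3.smul c, h4.smul c, ?_⟩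
      change c • χ = _
      rw [show χ = χ₁ + χ₂ from h5, smul_add]

/-- The graph of the Laplacian `Δ_E^p` as an unbounded operator on the square-integrable forms:
the closure of the Laplacian on compactly supported smooth forms (which is self-adjoint, because
the manifold is complete). -/
def laplacianL2 : Submodule ℂ (L2Form h p × L2Form h p) :=
  ((laplacianGraph h conn p).map ((toL2 h p).prodMap (toL2 h p))).topologicalClosure

/-- The kernel of `Δ_E^p` in the space of square-integrable forms. -/
def laplacianKer : Submodule ℂ (L2Form h p) :=
  (laplacianL2 h conn p).comap (LinearMap.inl ℂ (L2Form h p) (L2Form h p))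

instance : CompleteSpace (laplacianKer h conn p) := by
  have h1 : IsClosed ((laplacianKer h conn p : Submodule ℂ (L2Form h p)) : Set (L2Form h p)) :=
    (Submodule.isClosed_topologicalClosure _).preimage
      (Continuous.prodMk continuous_id continuous_const)
  exact h1.completeSpace_coe

/-- The orthogonal projection `P_p` onto the `L²`-kernel of `Δ_E^p`. -/
def kerProj : L2Form h p →L[ℂ] L2Form h p := (laplacianKer h conn p).starProjection

/-- `S` is the heat semigroup `t ↦ e^{-tΔ}`, `t ≥ 0`, of the operator `Δ_E^p`: for every
square-integrable form `u`, the function `t ↦ S t u` is continuous on `[0, ∞)` with value `u`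
at `0` and solves `∂u/∂t = -Δ u` for `t > 0`. -/
def IsHeatSemigroup (S : ℝ → L2Form h p →L[ℂ] L2Form h p) : Prop :=
  ∀ u, S 0 u = u ∧ ContinuousOn (fun t ↦ S t u) (Ici 0) ∧
    ∀ t > 0, ∃ w, (S t u, w) ∈ laplacianL2 h conn p ∧ HasDerivAt (fun t' ↦ S t' u) (-w) t

open Classical in
/-- The heat operator `e^{-t Δ_E^p}`. -/
def heatOp (t : ℝ) : L2Form h p →L[ℂ] L2Form h p :=
  if hS : ∃ S, IsHeatSemigroup h conn p S then hS.choose t else 0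

end Laplacian

/-! ### Smooth kernels and the `g`-trace -/

section GTrace

/-- The homogeneous space `G/Z`, where `Z` is the centraliser of `g`,
with its Borel `σ`-algebra. -/
def ConjSpace {G : Type*} [Group G] (g : G) : Type _ := G ⧸ Subgroup.centralizer ({g} : Set G)

section ConjSpace

variable {G : Type*} [Group G] (g : G)

instance : MulAction G (ConjSpace g) :=
  inferInstanceAs (MulAction G (G ⧸ Subgroup.centralizer ({g} : Set G)))

instance [TopologicalSpace G] : TopologicalSpace (ConjSpace g) :=
  inferInstanceAs (TopologicalSpace (G ⧸ Subgroup.centralizer ({g} : Set G)))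

instance [TopologicalSpace G] : MeasurableSpace (ConjSpace g) := borel _

instance [TopologicalSpace G] : BorelSpace (ConjSpace g) := ⟨rfl⟩

/-- The map `hZ ↦ h g h⁻¹` from `G/Z` to the conjugacy class of `g`. -/
def conjBy : ConjSpace g → G :=
  Quotient.lift (s := QuotientGroup.leftRel (Subgroup.centralizer ({g} : Set G)))
    (fun h : G ↦ h * g * h⁻¹) (by
      intro a b hab
      have h1 : g * (a⁻¹ * b) = a⁻¹ * b * g :=
        Subgroup.mem_centralizer_iff.1 (QuotientGroup.leftRel_apply.1 hab) g rfl
      have h2 : a * (g * (a⁻¹ * b)) * b⁻¹ = a * (a⁻¹ * b * g) * b⁻¹ := by rw [h1]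
      simpa [mul_assoc] using h2)

end ConjSpace

variable {n : ℕ} {M : Type*} [TopologicalSpace M] [ChartedSpace (EuclideanSpace ℝ (Fin n)) M]
  {F : Type*} [NormedAddCommGroup F] [NormedSpace ℂ F]
  {E : M → Type*} [∀ m, AddCommGroup (E m)] [∀ m, Module ℂ (E m)]
  [TopologicalSpace (TotalSpace F E)] [∀ m, TopologicalSpace (E m)]
  [FiberBundle F E]

/-- `ψ` is a cutoff function for the action of `G` on `M`: a smooth, compactly supported,
nonnegative function with `∫_G ψ(xm) dx = 1` for all `m`. -/
structure IsCutoff (n : ℕ) {M : Type*} [TopologicalSpace M]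
    [ChartedSpace (EuclideanSpace ℝ (Fin n)) M] {G : Type*} [Group G] [MeasurableSpace G]
    [MulAction G M] (μ : Measure G) (ψ : M → ℝ) : Prop where
  smooth : ContMDiff (𝓡 n) 𝓘(ℝ, ℝ) ∞ ψ
  compact : HasCompactSupport ψ
  nonneg : ∀ m, 0 ≤ ψ m
  integral_eq_one : ∀ m : M, ∫ x : G, ψ (x • m) ∂μ = 1

variable (n E) in
/-- Schwartz kernels on `W = ⋀^p T*M ⊗ E`: the value at `(m, m')` is a linear map `W_{m'} → W_m`. -/
abbrev FormKernel (p : ℕ) : Type _ := Π m m' : M, FormFibre n E p m' →ₗ[ℂ] FormFibre n E p m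

variable {G : Type*} [Group G] [TopologicalSpace G] [MulAction G M]

/-- The action of `x ∈ G` as a map from `W_{x⁻¹m}` to `W_m`, where `W = ⋀^p T*M ⊗ E`. The action
of `x` is the pullback by `x⁻¹`, so
`(x · β)(v₁, …, v_p) = x (β (d(x⁻¹) v₁, …, d(x⁻¹) v_p))`; the map `x : E_{x⁻¹m} → E_m` is the
inverse of `x⁻¹ : E_m → E_{x⁻¹m}`. -/
def formAct (ρ : BundleAction n F E G) {p : ℕ} (x : G) (m : M) :
    FormFibre n E p (x⁻¹ • m) →ₗ[ℂ] FormFibre n E p m where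
  toFun β := ((ρ.act x⁻¹ m).symm.toLinearMap.restrictScalars ℝ).compAlternatingMap
    (β.compLinearMap (mfderiv (𝓡 n) (𝓡 n) (fun m' : M ↦ x⁻¹ • m') m).toLinearMap)
  map_add' β γ := by ext v; simp
  map_smul' c β := by ext v; simp

/-- The function `m ↦ ψ(xm) tr(x κ(x⁻¹m, m))`. -/
def gTraceIntegrand (ρ : BundleAction n F E G) (ψ : M → ℝ) {p : ℕ} (κ : FormKernel n E p)
    (x : G) (m : M) : ℂ :=
  (ψ (x • m) : ℂ) * LinearMap.trace ℂ (FormFibre n E p m) (formAct ρ x m ∘ₗ κ (x⁻¹ • m) m)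

variable [IsManifold (𝓡 n) ∞ M] [VectorBundle ℝ F E] [VectorBundle ℂ F E]

variable (F) in
/-- The kernel `κ` is smooth. -/
def IsSmoothKernel {p : ℕ} (κ : FormKernel n E p) : Prop :=
  ∀ (β : TestForm n F E p) (m₀ : M) (v : Fin p → EuclideanSpace ℝ (Fin n)),
    ∀ m ∈ (chartAt (EuclideanSpace ℝ (Fin n)) m₀).source, ∀ m' : M,
      ContMDiffAt ((𝓡 n).prod (𝓡 n)) ((𝓡 n).prod 𝓘(ℝ, F)) ∞
        (fun q : M × M ↦ TotalSpace.mk' F q.1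
          (κ q.1 q.2 (β.1 q.2) (fun i ↦ coordField m₀ (v i) q.1))) (m, m')

variable [RiemannianBundle (fun m : M ↦ TangentSpace (𝓡 n) m)]
  [T2Space M] [SigmaCompactSpace M] [MeasurableSpace M]

/-- The double integral defining the `g`-trace,
`∫_{G/Z} ∫_M ψ(hgh⁻¹m) tr(hgh⁻¹ κ(hg⁻¹h⁻¹m, m)) dm d(hZ)`. -/
def gTraceIntegral (ρ : BundleAction n F E G) (g : G) (ν : Measure (ConjSpace g)) (ψ : M → ℝ)
    {p : ℕ} (κ : FormKernel n E p) : ℂ :=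
  ∫ q, ∫ m, gTraceIntegrand ρ ψ κ (conjBy g q) m ∂(riemannianVolume n M) ∂ν

/-- The double integral defining the `g`-trace converges absolutely. -/
structure GTraceConverges (ρ : BundleAction n F E G) (g : G) (ν : Measure (ConjSpace g))
    (ψ : M → ℝ) {p : ℕ} (κ : FormKernel n E p) : Prop where
  inner : ∀ᵐ q ∂ν, Integrable (gTraceIntegrand ρ ψ κ (conjBy g q)) (riemannianVolume n M)
  measurable : AEStronglyMeasurable
    (fun q ↦ ∫ m, gTraceIntegrand ρ ψ κ (conjBy g q) m ∂(riemannianVolume n M)) ν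
  finite : ∫⁻ q, ∫⁻ m, ‖gTraceIntegrand ρ ψ κ (conjBy g q) m‖ₑ ∂(riemannianVolume n M) ∂ν < ⊤

variable [BorelSpace M] [IsContMDiffRiemannianBundle (𝓡 n) ∞ (EuclideanSpace ℝ (Fin n))
  (fun m : M ↦ TangentSpace (𝓡 n) m)]

/-- `κ` is the Schwartz kernel of the operator `T`, that is,
`(T β)(m) = ∫_M κ(m, m') β(m') dm'`, tested against compactly supported smooth forms. -/
def HasKernel (h : HermitianMetric n F E) {p : ℕ} (T : L2Form h p →L[ℂ] L2Form h p)
    (κ : FormKernel n E p) : Prop :=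
  ∀ α β : TestForm n F E p, inner ℂ (toL2 h p α) (T (toL2 h p β)) =
    ∫ m, ∫ m', h.formInner m (α.1 m) (κ m m' (β.1 m'))
      ∂(riemannianVolume n M) ∂(riemannianVolume n M)

/-- `T` has a smooth kernel and is `g`-trace class. -/
def IsGTraceClass (ρ : BundleAction n F E G) (g : G) (ν : Measure (ConjSpace g)) (ψ : M → ℝ)
    (h : HermitianMetric n F E) {p : ℕ} (T : L2Form h p →L[ℂ] L2Form h p) : Prop :=
  ∃ κ : FormKernel n E p, IsSmoothKernel F κ ∧ HasKernel h T κ ∧ GTraceConverges ρ g ν ψ κ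

open Classical in
/-- The `g`-trace of an operator `T` with a smooth kernel. -/
def gTrace (ρ : BundleAction n F E G) (g : G) (ν : Measure (ConjSpace g)) (ψ : M → ℝ)
    (h : HermitianMetric n F E) {p : ℕ} (T : L2Form h p →L[ℂ] L2Form h p) : ℂ :=
  if hκ : ∃ κ : FormKernel n E p, IsSmoothKernel F κ ∧ HasKernel h T κ then
    gTraceIntegral ρ g ν ψ hκ.choose else 0

variable [∀ m, IsTopologicalAddGroup (E m)] [∀ m, ContinuousSMul ℝ (E m)]

/-! ### Equivariant analytic torsion -/

/-- The function `𝒯_g(t) = ∑_p (-1)^p p Tr_g(e^{-t Δ_E^p} - P_p)`. -/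
def curlyT (conn : FlatConnection n F E) (ρ : BundleAction n F E G) (g : G)
    (ν : Measure (ConjSpace g)) (ψ : M → ℝ) (h : HermitianMetric n F E) (t : ℝ) : ℂ :=
  ∑ p ∈ Finset.range (n + 1), (-1 : ℂ) ^ p * p *
    gTrace ρ g ν ψ h (heatOp h conn p t - kerProj h conn p)

/-- `Z` is a meromorphic continuation to `ℂ`, regular at `0`, of
`s ↦ Γ(s)⁻¹ ∫_0^1 t^{s-1} T(t) dt`; in particular this integral converges when the real part of
`s` is large enough. -/
def IsZetaContinuation (T : ℝ → ℂ) (Z : ℂ → ℂ) : Prop :=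
  (∃ σ : ℝ, ∀ s : ℂ, σ < s.re →
    IntegrableOn (fun t : ℝ ↦ (t : ℂ) ^ (s - 1) * T t) (Ioc 0 1) ∧
    Z s = (Complex.Gamma s)⁻¹ * ∫ t in Ioc (0 : ℝ) 1, (t : ℂ) ^ (s - 1) * T t) ∧
  MeromorphicOn Z univ ∧ AnalyticAt ℂ Z 0

/-- The conditions under which equivariant analytic torsion is defined. -/
structure TorsionConditions (conn : FlatConnection n F E) (ρ : BundleAction n F E G) (g : G)
    (ν : Measure (ConjSpace g)) (ψ : M → ℝ) (h : HermitianMetric n F E) : Prop where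
  traceClass : ∀ t > 0, ∀ p, IsGTraceClass ρ g ν ψ h (heatOp h conn p t - kerProj h conn p)
  decay : ∃ a > 0, curlyT conn ρ g ν ψ h =O[atTop] fun t : ℝ ↦ t ^ (-a : ℝ)
  continuation : ∃ Z, IsZetaContinuation (curlyT conn ρ g ν ψ h) Z

open Classical in
/-- The number `-2 log T_g(∇^E)`: the derivative at `s = 0` of the continuation of
`Γ(s)⁻¹ ∫_0^1 t^{s-1} 𝒯_g(t) dt` plus `∫_1^∞ t⁻¹ 𝒯_g(t) dt`. -/
def minusTwoLogTorsion (conn : FlatConnection n F E) (ρ : BundleAction n F E G) (g : G)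
    (ν : Measure (ConjSpace g)) (ψ : M → ℝ) (h : HermitianMetric n F E) : ℂ :=
  (if hZ : ∃ Z, IsZetaContinuation (curlyT conn ρ g ν ψ h) Z then deriv hZ.choose 0 else 0) +
    ∫ t in Ioi (1 : ℝ), (t : ℂ)⁻¹ * curlyT conn ρ g ν ψ h t

/-- The equivariant analytic torsion `T_g(∇^E)`. -/
def analyticTorsion (conn : FlatConnection n F E) (ρ : BundleAction n F E G) (g : G)
    (ν : Measure (ConjSpace g)) (ψ : M → ℝ) (h : HermitianMetric n F E) : ℂ :=
  Complex.exp (-(1 / 2) * minusTwoLogTorsion conn ρ g ν ψ h)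

end GTrace

end EquivariantTorsion

end

/-!
Let `A` be the field of endomorphisms of `E` with `h' = h(A ·, ·)`. It is smooth, because in a local
frame it is computed with the inverse Gram matrix of `h`, it is self-adjoint for `h`, and it is
parallel, because both metrics are (`HermitianMetric.cov_ratio`). Applied to the coefficients of a
form, `A` therefore commutes with `∇`, and `(α, β)_{h'} = (α, A β)_h` for the `L²`-inner products.
Pairing `∇* β` with `A α` for `h` then shows that `∇*` is also the formal adjoint for `h'`
(`IsFormalAdjoint.of_preserved`); no integration by parts is needed. So the Laplacian is the same
for both metrics, and it commutes with `A`.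

As both metrics are invariant and the action is cocompact, they are uniformly comparable
(`HermitianMetric.exists_bound`), and the identity of the compactly supported smooth forms extends
to an isomorphism `Φ` of the spaces of square-integrable forms, in general not unitary. It
intertwines the closures of the Laplacian. On test forms `Φ* Φ` is `A`, so `Φ* Φ` preserves the
kernel of the Laplacian; hence `Φ` preserves orthogonality to this kernel and intertwines the
projections `P` (`kerProj_map_apply`). It intertwines the heat operators because solutions of the
heat equation are determined by their initial values: the Laplacian is nonnegative, so the norm of
a solution does not increase (`IsHeatSemigroup.eq_of_nonneg`). Finally, `κ` is a Schwartz kernel of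
`T` for `h` if and only if it is one of `Φ T Φ⁻¹` for `h'` (`hasKernel_congr`): test with `A α` in
place of `α`. The `g`-trace depends only on the kernel, so the functions `𝒯_g` for `h` and `h'`
agree on `t > 0`, and so do the torsions.
-/

noncomputable section

namespace EquivariantTorsion

/-! ### Sesquilinear forms on finite-dimensional spaces -/

section Sesquilinear

variable {V : Type*} [AddCommGroup V] [Module ℂ V]

/-- Finite-dimensional Riesz representation for a definite sesquilinear form. -/
theorem exists_sesq_eq_of_definite [FiniteDimensional ℂ V] (B : V →ₗ⋆[ℂ] V →ₗ[ℂ] ℂ)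
    (hB : ∀ v, v ≠ 0 → 0 < (B v v).re) (f : V →ₗ[ℂ] ℂ) : ∃ u, B u = f := by
  -- Viewed as an `ℝ`-linear map into the dual, `B` is injective between spaces of equal dimension.
  let T : V →ₗ[ℝ] Module.Dual ℂ V :=
    { toFun := B
      map_add' := map_add B
      map_smul' := fun r v ↦ by
        have := B.map_smulₛₗ (r : ℂ) v
        rw [Complex.conj_ofReal] at this
        rw [Complex.coe_smul, Complex.coe_smul] at this
        exact this }
  have hinj : Function.Injective T := by
    refine (injective_iff_map_eq_zero T).2 fun v hv ↦ ?_
    by_contra hne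
    have h1 := hB v hne
    have h2 : B v = 0 := hv
    simp [h2] at h1
  have : FiniteDimensional ℝ V := FiniteDimensional.complexToReal V
  have : FiniteDimensional ℝ (Module.Dual ℂ V) := FiniteDimensional.complexToReal _
  have hdim : Module.finrank ℝ V = Module.finrank ℝ (Module.Dual ℂ V) := by
    rw [finrank_real_of_complex, finrank_real_of_complex, Subspace.dual_finrank_eq]
  exact (LinearMap.injective_iff_surjective_of_finrank_eq_finrank hdim).1 hinj f

theorem isUnit_det_gram_of_definite {ι : Type*} [Fintype ι] [DecidableEq ι]
    (B : V →ₗ⋆[ℂ] V →ₗ[ℂ] ℂ) (hB : ∀ v, v ≠ 0 → 0 < (B v v).re) {b : ι → V}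
    (hb : LinearIndependent ℂ b) :
    IsUnit (Matrix.of fun i j ↦ B (b i) (b j)).det := by
  rw [isUnit_iff_ne_zero]
  intro h0
  obtain ⟨c, hc, hc0⟩ := Matrix.exists_mulVec_eq_zero_iff.2 h0
  have hv : ∑ i, c i • b i ≠ 0 := fun h ↦
    hc (funext fun i ↦ Fintype.linearIndependent_iff.1 hb c h i)
  have h1 := hB _ hv
  have h2 : B (∑ i, c i • b i) (∑ i, c i • b i) = ∑ i, conj (c i) * ∑ j, B (b i) (b j) * c j := by
    simp only [map_sum, LinearMap.map_smulₛₗ, LinearMap.sum_apply, LinearMap.smul_apply, map_smul,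
      smul_eq_mul, Finset.mul_sum]
    rw [Finset.sum_comm]
    exact Finset.sum_congr rfl fun i _ ↦ Finset.sum_congr rfl fun j _ ↦ by ring
  have h3 : ∀ i, ∑ j, B (b i) (b j) * c j = 0 := fun i ↦ congrFun hc0 i
  rw [h2] at h1
  simp only [h3, mul_zero, Finset.sum_const_zero, Complex.zero_re, lt_irrefl] at h1

/-- The coordinates of a vector are recovered from its products with the basis vectors by means of
the inverse Gram matrix. -/
theorem repr_eq_gram_inv {ι : Type*} [Fintype ι] [DecidableEq ι]
    (B : V →ₗ⋆[ℂ] V →ₗ[ℂ] ℂ) (hB : ∀ v, v ≠ 0 → 0 < (B v v).re) (b : Module.Basis ι ℂ V)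
    (v : V) (i : ι) :
    b.repr v i = conj (∑ j, B v (b j) * (Matrix.of fun i j ↦ B (b i) (b j))⁻¹ j i) := by
  set H := Matrix.of fun i j ↦ B (b i) (b j) with hH
  have h1 : (fun j ↦ B v (b j)) = Matrix.vecMul (fun i ↦ conj (b.repr v i)) H := by
    ext j
    conv_lhs => rw [← b.sum_repr v]
    simp only [map_sum, LinearMap.map_smulₛₗ, LinearMap.sum_apply, LinearMap.smul_apply,
      smul_eq_mul, Matrix.vecMul, dotProduct, hH, Matrix.of_apply]
  have h2 : Matrix.vecMul (fun j ↦ B v (b j)) H⁻¹ = fun i ↦ conj (b.repr v i) := by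
    rw [h1, Matrix.vecMul_vecMul,
      Matrix.mul_nonsing_inv _ (isUnit_det_gram_of_definite B hB b.linearIndependent),
      Matrix.vecMul_one]
  have h3 : ∑ j, B v (b j) * H⁻¹ j i = conj (b.repr v i) := congrFun h2 i
  rw [h3, Complex.conj_conj]

theorem contDiffAt_det {ι : Type*} [Fintype ι] [DecidableEq ι] {k : WithTop ℕ∞}
    {X : Type*} [NormedAddCommGroup X] [NormedSpace ℝ X] {f : X → Matrix ι ι ℂ} {x : X}
    (hf : ∀ i j, ContDiffAt ℝ k (fun y ↦ f y i j) x) :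
    ContDiffAt ℝ k (fun y ↦ (f y).det) x := by
  simp only [Matrix.det_apply]
  refine ContDiffAt.sum fun σ _ ↦ ?_
  exact (contDiffAt_prod fun i _ ↦ hf _ _).const_smul _

theorem contDiffAt_matrix_inv {ι : Type*} [Fintype ι] [DecidableEq ι] {k : WithTop ℕ∞}
    {X : Type*} [NormedAddCommGroup X] [NormedSpace ℝ X] {f : X → Matrix ι ι ℂ} {x : X}
    (hf : ∀ i j, ContDiffAt ℝ k (fun y ↦ f y i j) x) (hx : IsUnit (f x).det) (i j : ι) :
    ContDiffAt ℝ k (fun y ↦ (f y)⁻¹ i j) x := by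
  simp only [Matrix.inv_def, Ring.inverse_eq_inv', Matrix.smul_apply, smul_eq_mul,
    Matrix.adjugate_apply]
  refine ((contDiffAt_det hf).inv hx.ne_zero).mul (contDiffAt_det fun k l ↦ ?_)
  by_cases h : k = j
  · subst h
    simpa using contDiffAt_const
  · simpa [Matrix.updateRow_ne h] using hf k l

end Sesquilinear

/-! ### The endomorphism field comparing two Hermitian metrics -/

section Comparison

variable {n : ℕ} {M : Type*} [TopologicalSpace M] [ChartedSpace (EuclideanSpace ℝ (Fin n)) M]
  {F : Type*} [NormedAddCommGroup F] [NormedSpace ℂ F]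
  {E : M → Type*} [∀ m, AddCommGroup (E m)] [∀ m, Module ℂ (E m)]
  [TopologicalSpace (TotalSpace F E)] [∀ m, TopologicalSpace (E m)]
  [FiberBundle F E] [VectorBundle ℂ F E]

/-- The basis of the fibre over `m` that corresponds to a basis of the model fibre under a
trivialization around `m₀`. -/
def fibreBasis {ι : Type*} (b : Module.Basis ι ℂ F) (m₀ : M) {m : M}
    (hm : m ∈ (trivializationAt F E m₀).baseSet) : Module.Basis ι ℂ (E m) :=
  b.map ((trivializationAt F E m₀).linearEquivAt ℂ m hm).symm

theorem trivializationAt_eq_sum_repr {ι : Type*} [Fintype ι] (b : Module.Basis ι ℂ F) (m₀ : M)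
    {m : M} (hm : m ∈ (trivializationAt F E m₀).baseSet) (v : E m) :
    (trivializationAt F E m₀ ⟨m, v⟩).2 = ∑ i, (fibreBasis b m₀ hm).repr v i • b i := by
  have h1 := b.sum_repr ((trivializationAt F E m₀).linearEquivAt ℂ m hm v)
  exact h1.symm

theorem finiteDimensional_fibre [FiniteDimensional ℂ F] (m : M) : FiniteDimensional ℂ (E m) :=
  ((trivializationAt F E m).linearEquivAt ℂ m
    (FiberBundle.mem_baseSet_trivializationAt F E m)).symm.finiteDimensional

variable [IsManifold (𝓡 n) ∞ M] [VectorBundle ℝ F E] [ContMDiffVectorBundle ∞ F E (𝓡 n)]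

/-- Sections that are constant in a trivialization are smooth on its base set. -/
theorem smoothSectionAt_symm_const (m₀ : M) (w : F) {m : M}
    (hm : m ∈ (trivializationAt F E m₀).baseSet) :
    SmoothSectionAt n F (fun m' ↦ (trivializationAt F E m₀).symm m' w) m := by
  set e := trivializationAt F E m₀ with he
  unfold SmoothSectionAt
  rw [e.contMDiffAt_section_iff (IB := 𝓡 n) hm]
  refine (contMDiffAt_const (c := w)).congr_of_eventuallyEq ?_
  filter_upwards [e.open_baseSet.mem_nhds hm] with x hx
  rw [e.mk_symm hx, e.apply_symm_apply' hx]

theorem smoothSectionAt_extend {m : M} (w : E m) :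
    SmoothSectionAt n F (FiberBundle.extend F w) m :=
  smoothSectionAt_symm_const m _ (FiberBundle.mem_baseSet_trivializationAt F E m)

variable [FiniteDimensional ℂ F]

theorem HermitianMetric.exists_form_eq (h : HermitianMetric n F E) (m : M) (f : E m →ₗ[ℂ] ℂ) :
    ∃ u, h.form m u = f :=
  have := finiteDimensional_fibre (F := F) (E := E) m
  exists_sesq_eq_of_definite (h.form m) (h.pos m) f

theorem HermitianMetric.eq_of_forall_form_eq (h : HermitianMetric n F E) {m : M} {u v : E m}
    (huv : ∀ w, h.form m u w = h.form m v w) : u = v := by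
  by_contra hne
  have h1 := h.pos m (u - v) (sub_ne_zero.2 hne)
  have h2 : h.form m (u - v) = 0 := by
    ext w
    simp [huv w]
  simp [h2] at h1

/-- The endomorphism `A` of the fibre `E m` with `h' = h(A ·, ·)`. -/
def HermitianMetric.ratio (h h' : HermitianMetric n F E) (m : M) : E m →ₗ[ℂ] E m where
  toFun v := (h.exists_form_eq m (h'.form m v)).choose
  map_add' u v := by
    refine h.eq_of_forall_form_eq fun w ↦ ?_
    rw [map_add (h.form m), (h.exists_form_eq m _).choose_spec,
      (h.exists_form_eq m _).choose_spec, (h.exists_form_eq m _).choose_spec, map_add]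
  map_smul' c v := by
    refine h.eq_of_forall_form_eq fun w ↦ ?_
    rw [RingHom.id_apply, LinearMap.map_smulₛₗ (h.form m), (h.exists_form_eq m _).choose_spec,
      (h.exists_form_eq m _).choose_spec, LinearMap.map_smulₛₗ]

variable (h h' : HermitianMetric n F E)

theorem HermitianMetric.form_ratio_left (m : M) (v w : E m) :
    h.form m (h.ratio h' m v) w = h'.form m v w :=
  LinearMap.congr_fun (h.exists_form_eq m (h'.form m v)).choose_spec w

theorem HermitianMetric.form_ratio_right (m : M) (v w : E m) :
    h.form m v (h.ratio h' m w) = h'.form m v w := by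
  rw [← h.conj_symm, h.form_ratio_left, h'.conj_symm]

/-- In a local frame, `A s` is obtained from the products of `s` with the frame by means of the
inverse Gram matrix of `h`, which depends smoothly on the point. -/
theorem HermitianMetric.smoothSectionAt_ratio {s : Π m, E m} {m : M}
    (hs : SmoothSectionAt n F s m) : SmoothSectionAt n F (fun m' ↦ h.ratio h' m' (s m')) m := by
  classical
  set e := trivializationAt F E m with he
  have hm : m ∈ e.baseSet := FiberBundle.mem_baseSet_trivializationAt F E m
  set b := Module.finBasis ℂ F
  set X := Fin (Module.finrank ℂ F) → Fin (Module.finrank ℂ F) → ℂ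
  set Y := Fin (Module.finrank ℂ F) → ℂ
  let σ i m' := e.symm m' (b i)
  have hσ i : SmoothSectionAt n F (σ i) m := smoothSectionAt_symm_const m (b i) hm
  let gr (m' : M) : X × Y := (fun i j ↦ h.form m' (σ i m') (σ j m'),
    fun j ↦ h'.form m' (s m') (σ j m'))
  let Φ (q : X × Y) : F := ∑ i, conj (∑ j, q.2 j * (Matrix.of q.1)⁻¹ j i) • b i
  have hgr : ContMDiffAt (𝓡 n) 𝓘(ℝ, X × Y) ∞ gr m := by
    refine ContMDiffAt.prodMk_space ?_ ?_
    · exact contMDiffAt_pi_space.2 fun i ↦ contMDiffAt_pi_space.2 fun j ↦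
        h.smooth _ _ m (hσ i) (hσ j)
    · exact contMDiffAt_pi_space.2 fun j ↦ h'.smooth _ _ m hs (hσ j)
  have hΦ : ContDiffAt ℝ ∞ Φ (gr m) := by
    refine ContDiffAt.sum fun i _ ↦ ContDiffAt.smul ?_ contDiffAt_const
    refine Complex.conjCLE.contDiff.contDiffAt.comp (gr m)
      (ContDiffAt.sum fun j _ ↦ ContDiffAt.mul ?_ ?_)
    · fun_prop
    · refine contDiffAt_matrix_inv (fun k l ↦ ?_) ?_ j i
      · simp only [Matrix.of_apply]
        fun_prop
      · exact isUnit_det_gram_of_definite (h.form m) (h.pos m)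
          (fibreBasis b m hm).linearIndependent
  unfold SmoothSectionAt
  rw [contMDiffAt_section]
  refine (hΦ.contMDiffAt.comp m hgr).congr_of_eventuallyEq ?_
  filter_upwards [e.open_baseSet.mem_nhds hm] with x hx
  rw [trivializationAt_eq_sum_repr b m hx]
  refine Finset.sum_congr rfl fun i _ ↦ ?_
  rw [repr_eq_gram_inv (h.form x) (h.pos x)]
  simp only [h.form_ratio_left]
  rfl

variable [∀ m, IsTopologicalAddGroup (E m)] [∀ m, ContinuousSMul ℝ (E m)]

/-- The comparison endomorphism of two parallel metrics is parallel. -/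
theorem HermitianMetric.cov_ratio {h h' : HermitianMetric n F E} {conn : FlatConnection n F E}
    (hP : h.IsPreservedBy conn) (hP' : h'.IsPreservedBy conn) {s : Π m, E m} {m : M}
    (hs : SmoothSectionAt n F s m) (v : TangentSpace (𝓡 n) m) :
    conn.cov (fun m' ↦ h.ratio h' m' (s m')) m v = h.ratio h' m (conn.cov s m v) := by
  refine h.eq_of_forall_form_eq fun w ↦ ?_
  -- Both metrics are differentiated on `s` and an extension of `w`; the terms with the derivative
  -- of the extension agree.
  have ht := smoothSectionAt_extend (n := n) (F := F) w
  have h1 := hP _ _ m (h.smoothSectionAt_ratio h' hs) ht v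
  have h2 := hP' _ _ m hs ht v
  simp only [h.form_ratio_left] at h1
  rw [h2] at h1
  rw [h.form_ratio_left]
  simpa using h1.symm

end Comparison

/-! ### The comparison endomorphism on differential forms -/

section FormComparison

variable {n : ℕ} {M : Type*} [TopologicalSpace M] [ChartedSpace (EuclideanSpace ℝ (Fin n)) M]
  [IsManifold (𝓡 n) ∞ M]
  {F : Type*} [NormedAddCommGroup F] [NormedSpace ℂ F] [FiniteDimensional ℂ F]
  {E : M → Type*} [∀ m, AddCommGroup (E m)] [∀ m, Module ℂ (E m)]
  [TopologicalSpace (TotalSpace F E)] [∀ m, TopologicalSpace (E m)]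
  [FiberBundle F E] [VectorBundle ℂ F E] [VectorBundle ℝ F E] [ContMDiffVectorBundle ∞ F E (𝓡 n)]

/-- The action of the comparison endomorphism on the coefficients of a test form. -/
def HermitianMetric.ratioForm (h h' : HermitianMetric n F E) {p : ℕ} (α : TestForm n F E p) :
    TestForm n F E p :=
  ⟨fun m ↦ ((h.ratio h' m).restrictScalars ℝ).compAlternatingMap (α.1 m),
    fun m₀ v m hm ↦ h.smoothSectionAt_ratio h' (α.2.1 m₀ v m hm), by
      obtain ⟨K, hK, hαK⟩ := α.2.2
      exact ⟨K, hK, fun m hm ↦ by ext v; simp [hαK m hm]⟩⟩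

variable (h h' : HermitianMetric n F E)

theorem HermitianMetric.ratioForm_apply {p : ℕ} (α : TestForm n F E p) (m : M)
    (v : Fin p → TangentSpace (𝓡 n) m) :
    (h.ratioForm h' α).1 m v = h.ratio h' m (α.1 m v) := rfl

theorem HermitianMetric.ratioForm_add {p : ℕ} (α β : TestForm n F E p) :
    h.ratioForm h' (α + β) = h.ratioForm h' α + h.ratioForm h' β := by
  refine Subtype.ext (funext fun m ↦ AlternatingMap.ext fun v ↦ ?_)
  exact map_add (h.ratio h' m) (α.1 m v) (β.1 m v)

section Connection

variable [∀ m, IsTopologicalAddGroup (E m)] [∀ m, ContinuousSMul ℝ (E m)]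

theorem IsExtDeriv.ratioForm {h h' : HermitianMetric n F E} {conn : FlatConnection n F E}
    (hP : h.IsPreservedBy conn) (hP' : h'.IsPreservedBy conn) {p : ℕ} {α : TestForm n F E p}
    {β : TestForm n F E (p + 1)} (hαβ : IsExtDeriv conn α.1 β.1) :
    IsExtDeriv conn (h.ratioForm h' α).1 (h.ratioForm h' β).1 := by
  intro m v
  rw [h.ratioForm_apply, hαβ m v, map_sum]
  refine Finset.sum_congr rfl fun i _ ↦ ?_
  have h1 := HermitianMetric.cov_ratio hP hP'
    (α.2.1 m (fun j ↦ v (i.succAbove j)) m (mem_chart_source _ m)) (coordField m (v i) m)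
  rw [LinearMap.map_smul_of_tower]
  exact congrArg _ h1.symm

end Connection

variable [RiemannianBundle (fun m : M ↦ TangentSpace (𝓡 n) m)]

theorem HermitianMetric.formInner_ratioForm_left {p : ℕ} (m : M) (α : TestForm n F E p)
    (β : FormFibre n E p m) :
    h.formInner m ((h.ratioForm h' α).1 m) β = h'.formInner m (α.1 m) β := by
  simp only [HermitianMetric.formInner, h.ratioForm_apply, h.form_ratio_left]

theorem HermitianMetric.formInner_ratioForm_right {p : ℕ} (m : M) (α : FormFibre n E p m)
    (β : TestForm n F E p) :
    h.formInner m α ((h.ratioForm h' β).1 m) = h'.formInner m α (β.1 m) := by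
  simp only [HermitianMetric.formInner, h.ratioForm_apply, h.form_ratio_right]

variable [T2Space M] [SigmaCompactSpace M] [MeasurableSpace M]

theorem HermitianMetric.l2Inner_ratioForm_left {p : ℕ} (α β : TestForm n F E p) :
    h.l2Inner (h.ratioForm h' α) β = h'.l2Inner α β := by
  simp only [HermitianMetric.l2Inner, h.formInner_ratioForm_left]

theorem HermitianMetric.l2Inner_ratioForm_right {p : ℕ} (α β : TestForm n F E p) :
    h.l2Inner α (h.ratioForm h' β) = h'.l2Inner α β := by
  simp only [HermitianMetric.l2Inner, h.formInner_ratioForm_right]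

variable [∀ m, IsTopologicalAddGroup (E m)] [∀ m, ContinuousSMul ℝ (E m)]
  {h h'} {conn : FlatConnection n F E} (hP : h.IsPreservedBy conn) (hP' : h'.IsPreservedBy conn)

include hP hP'

/-- The formal adjoint of the connection is unchanged: pairing with `h'` is pairing with `h`
against `A α`, and `∇ A α = A ∇ α`. -/
theorem IsFormalAdjoint.of_preserved {p : ℕ} {β : TestForm n F E (p + 1)} {γ : TestForm n F E p}
    (hβ : IsFormalAdjoint h conn β γ) : IsFormalAdjoint h' conn β γ := by
  intro α α' hα
  rw [← h.l2Inner_ratioForm_right h', ← h.l2Inner_ratioForm_right h']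
  exact hβ _ _ (hα.ratioForm hP hP')

theorem IsFormalAdjoint.ratioForm {p : ℕ} {β : TestForm n F E (p + 1)} {γ : TestForm n F E p}
    (hβ : IsFormalAdjoint h conn β γ) :
    IsFormalAdjoint h conn (h.ratioForm h' β) (h.ratioForm h' γ) := by
  intro α α' hα
  rw [h.l2Inner_ratioForm_left, h.l2Inner_ratioForm_left]
  exact hβ.of_preserved hP hP' α α' hα

theorem IsLaplacian.of_preserved {p : ℕ} {α χ : TestForm n F E p}
    (hα : IsLaplacian h conn p α χ) : IsLaplacian h' conn p α χ := by
  cases p with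
  | zero =>
    obtain ⟨η, h1, h2⟩ := hα
    exact ⟨η, h1, h2.of_preserved hP hP'⟩
  | succ p =>
    obtain ⟨η, θ, χ₁, χ₂, h1, h2, h3, h4, h5⟩ := hα
    exact ⟨η, θ, χ₁, χ₂, h1, h2.of_preserved hP hP', h3.of_preserved hP hP', h4, h5⟩

theorem IsLaplacian.ratioForm {p : ℕ} {α χ : TestForm n F E p}
    (hα : IsLaplacian h conn p α χ) :
    IsLaplacian h conn p (h.ratioForm h' α) (h.ratioForm h' χ) := by
  cases p with
  | zero =>
    obtain ⟨η, h1, h2⟩ := hα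
    exact ⟨h.ratioForm h' η, h1.ratioForm hP hP', h2.ratioForm hP hP'⟩
  | succ p =>
    obtain ⟨η, θ, χ₁, χ₂, h1, h2, h3, h4, rfl⟩ := hα
    exact ⟨h.ratioForm h' η, h.ratioForm h' θ, h.ratioForm h' χ₁, h.ratioForm h' χ₂,
      h1.ratioForm hP hP', h2.ratioForm hP hP', h3.ratioForm hP hP', h4.ratioForm hP hP',
      h.ratioForm_add h' χ₁ χ₂⟩

end FormComparison

/-! ### Uniform comparison of invariant metrics -/

section Uniform

variable {n : ℕ} {M : Type*} [TopologicalSpace M] [ChartedSpace (EuclideanSpace ℝ (Fin n)) M]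
  {F : Type*} [NormedAddCommGroup F] [NormedSpace ℂ F] [FiniteDimensional ℂ F]
  {E : M → Type*} [∀ m, AddCommGroup (E m)] [∀ m, Module ℂ (E m)]
  [TopologicalSpace (TotalSpace F E)] [∀ m, TopologicalSpace (E m)]
  [FiberBundle F E] [VectorBundle ℂ F E]

theorem HermitianMetric.form_self_nonneg (h : HermitianMetric n F E) (m : M) (v : E m) :
    0 ≤ (h.form m v v).re := by
  rcases eq_or_ne v 0 with rfl | hv
  · simp
  · exact (h.pos m v hv).le

variable [IsManifold (𝓡 n) ∞ M] [VectorBundle ℝ F E] [ContMDiffVectorBundle ∞ F E (𝓡 n)]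

/-- Continuity of the squared norm of a vector as a function of the point and of the coordinates in a local frame. -/
theorem HermitianMetric.continuousOn_form_coord (h : HermitianMetric n F E) (m₀ : M)
    {ι : Type*} [Fintype ι] (b : Module.Basis ι ℂ F) :
    ContinuousOn (fun q : M × (ι → ℂ) ↦
      (h.form q.1 (∑ i, q.2 i • (trivializationAt F E m₀).symm q.1 (b i))
        (∑ i, q.2 i • (trivializationAt F E m₀).symm q.1 (b i))).re)
      ((trivializationAt F E m₀).baseSet ×ˢ univ) := by
  have hform i j : ContinuousOn (fun m ↦ h.form m ((trivializationAt F E m₀).symm m (b i))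
      ((trivializationAt F E m₀).symm m (b j))) (trivializationAt F E m₀).baseSet := fun m hm ↦
    (h.smooth _ _ m (smoothSectionAt_symm_const m₀ (b i) hm)
      (smoothSectionAt_symm_const m₀ (b j) hm)).continuousAt.continuousWithinAt
  simp only [map_sum, LinearMap.map_smulₛₗ, LinearMap.sum_apply, LinearMap.smul_apply, map_smul,
    smul_eq_mul]
  refine Complex.continuous_re.comp_continuousOn ?_
  refine continuousOn_finsetSum _ fun j _ ↦ ContinuousOn.mul (by fun_prop) ?_
  refine continuousOn_finsetSum _ fun i _ ↦ ContinuousOn.mul ?_ ?_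
  · exact (Complex.continuous_conj.comp
      ((continuous_apply i).comp continuous_snd)).continuousOn
  · exact (hform i j).comp continuousOn_fst fun q hq ↦ hq.1

/-- Two Hermitian metrics are locally comparable, by compactness of the unit sphere in the
model fibre. -/
theorem HermitianMetric.exists_local_bound (h h' : HermitianMetric n F E) (m₀ : M) :
    ∃ C : ℝ, ∀ᶠ m in 𝓝 m₀, ∀ v : E m, (h'.form m v v).re ≤ C * (h.form m v v).re := by
  have : LocallyCompactSpace M := ChartedSpace.locallyCompactSpace (EuclideanSpace ℝ (Fin n)) M
  set e := trivializationAt F E m₀ with he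
  have hm₀ : m₀ ∈ e.baseSet := FiberBundle.mem_baseSet_trivializationAt F E m₀
  obtain ⟨K, hKn, hKe, hK⟩ := local_compact_nhds (e.open_baseSet.mem_nhds hm₀)
  set b := Module.finBasis ℂ F
  let q (k : HermitianMetric n F E) (x : M × (Fin (Module.finrank ℂ F) → ℂ)) : ℝ :=
    (k.form x.1 (∑ i, x.2 i • e.symm x.1 (b i)) (∑ i, x.2 i • e.symm x.1 (b i))).re
  have hq k : ContinuousOn (q k) (K ×ˢ Metric.sphere 0 1) :=
    (k.continuousOn_form_coord m₀ b).mono (prod_mono hKe (subset_univ _))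
  have hcoord {m : M} (hm : m ∈ e.baseSet) (v : E m) :
      v = ∑ i, (fibreBasis b m₀ hm).repr v i • e.symm m (b i) :=
    ((fibreBasis b m₀ hm).sum_repr v).symm
  have hpos : ∀ x ∈ K ×ˢ Metric.sphere (0 : Fin (Module.finrank ℂ F) → ℂ) 1, 0 < q h x := by
    rintro ⟨m, c⟩ ⟨hm, hc⟩
    refine h.pos m _ fun h0 ↦ ?_
    have h1 := Fintype.linearIndependent_iff.1
      (fibreBasis b m₀ (hKe hm)).linearIndependent c h0
    have h2 : c = 0 := funext h1
    simp [h2] at hc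
  obtain ⟨C, hC⟩ := (hK.prod (isCompact_sphere 0 1)).exists_bound_of_continuousOn
    ((hq h').div (hq h) fun x hx ↦ (hpos x hx).ne')
  refine ⟨C, ?_⟩
  filter_upwards [hKn] with m hm v
  rcases eq_or_ne v 0 with rfl | hv
  · simp
  set c : Fin (Module.finrank ℂ F) → ℂ := fun i ↦ (fibreBasis b m₀ (hKe hm)).repr v i with hc
  have hvc : v = ∑ i, c i • e.symm m (b i) := hcoord (hKe hm) v
  have hc0 : c ≠ 0 := by
    intro h0
    rw [h0] at hvc
    simp [hv] at hvc
  have hr : 0 < ‖c‖ := norm_pos_iff.2 hc0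
  -- Scale to the unit sphere.
  have hs : (m, (‖c‖⁻¹ : ℂ) • c) ∈ K ×ˢ Metric.sphere (0 : Fin (Module.finrank ℂ F) → ℂ) 1 :=
    ⟨hm, by simp [norm_smul, hr.ne']⟩
  have hscale k : q k (m, (‖c‖⁻¹ : ℂ) • c) = ‖c‖⁻¹ ^ 2 * (k.form m v v).re := by
    have h1 : ∑ i, ((‖c‖⁻¹ : ℂ) • c) i • e.symm m (b i) = (‖c‖⁻¹ : ℂ) • v := by
      conv_rhs => rw [hvc]
      simp only [Finset.smul_sum, Pi.smul_apply, smul_assoc]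
    have h2 : q k (m, (‖c‖⁻¹ : ℂ) • c) =
      (k.form m ((‖c‖⁻¹ : ℂ) • v) ((‖c‖⁻¹ : ℂ) • v)).re := by simp only [q, h1]
    rw [h2, ← Complex.ofReal_inv, LinearMap.map_smulₛₗ (k.form m), LinearMap.smul_apply, map_smul,
      Complex.conj_ofReal, smul_eq_mul, smul_eq_mul, ← mul_assoc, ← Complex.ofReal_mul,
      Complex.re_ofReal_mul, sq]
  have h1 := (le_abs_self _).trans (hC _ hs)
  simp only [Pi.div_apply] at h1
  rw [div_le_iff₀ (hpos _ hs), hscale, hscale, mul_left_comm] at h1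
  exact le_of_mul_le_mul_left h1 (by positivity)

/-- Invariant metrics for a cocompact action are uniformly comparable. -/
theorem HermitianMetric.exists_bound {G : Type*} [Group G] [TopologicalSpace G] [MulAction G M]
    [ContinuousConstSMul G M] [CompactSpace (MulAction.orbitRel.Quotient G M)]
    {ρ : BundleAction n F E G} {h h' : HermitianMetric n F E}
    (hG : h.IsInvariant ρ) (hG' : h'.IsInvariant ρ) :
    ∃ C : ℝ, 0 ≤ C ∧ ∀ (m : M) (v : E m), (h'.form m v v).re ≤ C * (h.form m v v).re := by
  choose c hc using h.exists_local_bound h'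
  choose U hUc hUo hU using fun m₀ ↦ eventually_nhds_iff.1 (hc m₀)
  let quot : M → MulAction.orbitRel.Quotient G M := Quotient.mk''
  have hquot : IsOpenMap quot := isOpenMap_quotient_mk'_mul
  obtain ⟨t, ht⟩ := (isCompact_univ (X := MulAction.orbitRel.Quotient G M)).elim_finite_subcover
    (fun m₀ ↦ quot '' U m₀) (fun m₀ ↦ hquot _ (hUo m₀)) (by
      intro y _
      obtain ⟨m, rfl⟩ := Quotient.exists_rep y
      exact mem_iUnion.2 ⟨m, m, hU m, rfl⟩)
  refine ⟨∑ m₀ ∈ t, |c m₀|, Finset.sum_nonneg fun _ _ ↦ abs_nonneg _, fun m v ↦ ?_⟩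
  obtain ⟨m₀, hm₀, m₁, hm₁, hmm⟩ : ∃ m₀ ∈ t, ∃ m₁ ∈ U m₀, quot m₁ = quot m := by
    simpa using ht (mem_univ (quot m))
  obtain ⟨x, rfl⟩ : ∃ x : G, x • m = m₁ := by
    simpa [MulAction.orbitRel_apply, MulAction.mem_orbit_iff] using Quotient.exact hmm
  have h1 := hUc m₀ _ hm₁ (ρ.act x m v)
  rw [hG, hG'] at h1
  refine h1.trans (mul_le_mul_of_nonneg_right ?_ (h.form_self_nonneg m v))
  exact (le_abs_self _).trans
    (Finset.single_le_sum (f := fun m₀ ↦ |c m₀|) (fun _ _ ↦ abs_nonneg _) hm₀)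

end Uniform

/-! ### Comparison of the Hilbert spaces of square-integrable forms -/

section Hilbert

variable {H H' : Type*} [NormedAddCommGroup H] [InnerProductSpace ℂ H] [CompleteSpace H]
  [NormedAddCommGroup H'] [InnerProductSpace ℂ H'] [CompleteSpace H']

/-- Orthogonal projections are intertwined by an isomorphism `Φ`, not necessarily unitary, as soon
as `Φ* Φ` preserves the subspace: then `Φ` preserves orthogonality to it. -/
theorem starProjection_map_apply (Φ : H ≃L[ℂ] H') (K : Submodule ℂ H) (K' : Submodule ℂ H')
    [K.HasOrthogonalProjection] [K'.HasOrthogonalProjection] (hK : ∀ u, Φ u ∈ K' ↔ u ∈ K)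
    (hA : ∀ u ∈ K, (Φ : H →L[ℂ] H').adjoint (Φ u) ∈ K) (u : H) :
    K'.starProjection (Φ u) = Φ (K.starProjection u) := by
  refine Submodule.eq_starProjection_of_mem_of_inner_eq_zero ?_ ?_
  · exact (hK _).2 (K.starProjection_apply_mem u)
  · intro w hw
    obtain ⟨v, rfl⟩ := Φ.surjective w
    have hv : v ∈ K := (hK v).1 hw
    have h1 := K.starProjection_inner_eq_zero u _ (hA v hv)
    rw [← map_sub]
    rw [ContinuousLinearMap.adjoint_inner_right] at h1
    exact h1

theorem hasDerivAt_clm_comp (Φ : H →L[ℂ] H') {f : ℝ → H} {d : H} {t : ℝ}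
    (hf : HasDerivAt f d t) : HasDerivAt (fun t ↦ Φ (f t)) (Φ d) t :=
  (Φ.restrictScalars ℝ).hasFDerivAt.comp_hasDerivAt t hf

end Hilbert

section L2Comparison

variable {n : ℕ} {M : Type*} [TopologicalSpace M] [ChartedSpace (EuclideanSpace ℝ (Fin n)) M]
  [IsManifold (𝓡 n) ∞ M] [RiemannianBundle (fun m : M ↦ TangentSpace (𝓡 n) m)]
  {F : Type*} [NormedAddCommGroup F] [NormedSpace ℂ F]
  {E : M → Type*} [∀ m, AddCommGroup (E m)] [∀ m, Module ℂ (E m)]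
  [TopologicalSpace (TotalSpace F E)] [∀ m, TopologicalSpace (E m)]
  [FiberBundle F E] [VectorBundle ℝ F E] [VectorBundle ℂ F E]
  [T2Space M] [SigmaCompactSpace M] [MeasurableSpace M] [BorelSpace M]
  [IsContMDiffRiemannianBundle (𝓡 n) ∞ (EuclideanSpace ℝ (Fin n))
    (fun m : M ↦ TangentSpace (𝓡 n) m)]

theorem inner_toL2 (h : HermitianMetric n F E) {p : ℕ} (α β : TestForm n F E p) :
    inner ℂ (toL2 h p α) (toL2 h p β) = h.l2Inner α β :=
  UniformSpace.Completion.inner_coe (E := PreL2 h p) α β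

theorem denseRange_toL2 (h : HermitianMetric n F E) (p : ℕ) : DenseRange (toL2 h p) :=
  UniformSpace.Completion.denseRange_coe (α := PreL2 h p)

theorem formInner_self_le {h h' : HermitianMetric n F E} {C : ℝ}
    (hC : ∀ (m : M) (v : E m), (h'.form m v v).re ≤ C * (h.form m v v).re) {p : ℕ} (m : M)
    (α : FormFibre n E p m) : (h'.formInner m α α).re ≤ C * (h.formInner m α α).re := by
  have h1 : ((p.factorial : ℂ)⁻¹) = ((p.factorial : ℝ)⁻¹ : ℝ) := by simp
  rw [HermitianMetric.formInner, HermitianMetric.formInner, h1, Complex.re_ofReal_mul,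
    Complex.re_ofReal_mul, Complex.re_sum, Complex.re_sum, mul_left_comm,
    Finset.mul_sum (a := C)]
  exact mul_le_mul_of_nonneg_left (Finset.sum_le_sum fun I _ ↦ hC m _)
    (inv_nonneg.2 (Nat.cast_nonneg _))

theorem l2Inner_self_le {h h' : HermitianMetric n F E} {C : ℝ}
    (hC : ∀ (m : M) (v : E m), (h'.form m v v).re ≤ C * (h.form m v v).re) {p : ℕ}
    (α : TestForm n F E p) : (h'.l2Inner α α).re ≤ C * (h.l2Inner α α).re := by
  have hre (k : HermitianMetric n F E) :
      (k.l2Inner α α).re = ∫ m, (k.formInner m (α.1 m) (α.1 m)).re ∂(riemannianVolume n M) :=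
    (integral_re (𝕜 := ℂ) (integrable_formInner k α α)).symm
  rw [hre, hre, ← integral_const_mul]
  exact integral_mono (integrable_formInner h' α α).re
    ((integrable_formInner h α α).re.const_mul C) fun m ↦ formInner_self_le hC m _

/-- A comparison of the metrics extends the identity of the test forms to a bounded map between
the spaces of square-integrable forms. -/
theorem exists_clm_toL2 {h h' : HermitianMetric n F E} {C : ℝ} (hC0 : 0 ≤ C)
    (hC : ∀ (m : M) (v : E m), (h'.form m v v).re ≤ C * (h.form m v v).re) (p : ℕ) :
    ∃ Φ : L2Form h p →L[ℂ] L2Form h' p, ∀ α, Φ (toL2 h p α) = toL2 h' p α := by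
  let f : PreL2 h p →ₗ[ℂ] PreL2 h' p := (LinearMap.id : TestForm n F E p →ₗ[ℂ] TestForm n F E p)
  have hf : ∀ α : PreL2 h p, ‖f α‖ ≤ √C * ‖α‖ := by
    intro α
    have hn (k : HermitianMetric n F E) (β : PreL2 k p) :
        ‖β‖ = √(k.l2Inner (p := p) β β).re := norm_eq_sqrt_re_inner (𝕜 := ℂ) β
    rw [hn, hn, ← Real.sqrt_mul hC0]
    exact Real.sqrt_le_sqrt (l2Inner_self_le hC _)
  exact ⟨(f.mkContinuous _ hf).completion, fun α ↦
    ContinuousLinearMap.completion_apply_coe (f.mkContinuous _ hf) α⟩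

theorem exists_equiv_toL2 {h h' : HermitianMetric n F E} {C C' : ℝ} (hC0 : 0 ≤ C)
    (hC : ∀ (m : M) (v : E m), (h'.form m v v).re ≤ C * (h.form m v v).re) (hC0' : 0 ≤ C')
    (hC' : ∀ (m : M) (v : E m), (h.form m v v).re ≤ C' * (h'.form m v v).re) (p : ℕ) :
    ∃ Φ : L2Form h p ≃L[ℂ] L2Form h' p, ∀ α, Φ (toL2 h p α) = toL2 h' p α := by
  obtain ⟨Φ, hΦ⟩ := exists_clm_toL2 hC0 hC p
  obtain ⟨Ψ, hΨ⟩ := exists_clm_toL2 hC0' hC' p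
  refine ⟨ContinuousLinearEquiv.equivOfInverse Φ Ψ ?_ ?_, hΦ⟩
  · refine congrFun ((denseRange_toL2 h p).equalizer (Ψ.continuous.comp Φ.continuous)
      continuous_id (funext fun α ↦ ?_))
    simp [hΦ, hΨ]
  · refine congrFun ((denseRange_toL2 h' p).equalizer (Φ.continuous.comp Ψ.continuous)
      continuous_id (funext fun α ↦ ?_))
    simp [hΦ, hΨ]

/-- The inverse of `Φ` satisfies the characterization of `Φ` with the metrics exchanged. -/
theorem symm_apply_toL2 {h h' : HermitianMetric n F E} {p : ℕ} {Φ : L2Form h p ≃L[ℂ] L2Form h' p}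
    (hΦ : ∀ α, Φ (toL2 h p α) = toL2 h' p α) (α : TestForm n F E p) :
    Φ.symm (toL2 h' p α) = toL2 h p α := by
  rw [← hΦ, Φ.symm_apply_apply]

section Adjoint

variable [FiniteDimensional ℂ F] [ContMDiffVectorBundle ∞ F E (𝓡 n)]

/-- On test forms `Φ* Φ` is the comparison endomorphism. -/
theorem adjoint_apply_toL2 {h h' : HermitianMetric n F E} {p : ℕ}
    {Φ : L2Form h p ≃L[ℂ] L2Form h' p} (hΦ : ∀ α, Φ (toL2 h p α) = toL2 h' p α)
    (α : TestForm n F E p) :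
    (Φ : L2Form h p →L[ℂ] L2Form h' p).adjoint (toL2 h' p α) = toL2 h p (h.ratioForm h' α) := by
  refine (denseRange_toL2 h p).eq_of_inner_left (𝕜 := ℂ) fun β ↦ ?_
  rw [ContinuousLinearMap.adjoint_inner_left, inner_toL2, h.l2Inner_ratioForm_left]
  exact (congrArg _ (hΦ β)).trans (inner_toL2 h' α β)

end Adjoint

end L2Comparison

/-! ### The Laplacians, their kernels and the heat semigroups -/

section LaplacianComparison

variable {n : ℕ} {M : Type*} [TopologicalSpace M] [ChartedSpace (EuclideanSpace ℝ (Fin n)) M]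
  [IsManifold (𝓡 n) ∞ M] [RiemannianBundle (fun m : M ↦ TangentSpace (𝓡 n) m)]
  {F : Type*} [NormedAddCommGroup F] [NormedSpace ℂ F]
  {E : M → Type*} [∀ m, AddCommGroup (E m)] [∀ m, Module ℂ (E m)]
  [TopologicalSpace (TotalSpace F E)] [∀ m, TopologicalSpace (E m)]
  [FiberBundle F E] [∀ m, IsTopologicalAddGroup (E m)] [∀ m, ContinuousSMul ℝ (E m)]
  [VectorBundle ℝ F E] [VectorBundle ℂ F E]
  [T2Space M] [SigmaCompactSpace M] [MeasurableSpace M] [BorelSpace M]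
  [IsContMDiffRiemannianBundle (𝓡 n) ∞ (EuclideanSpace ℝ (Fin n))
    (fun m : M ↦ TangentSpace (𝓡 n) m)]

section Semigroup

variable {h : HermitianMetric n F E} {conn : FlatConnection n F E} {p : ℕ}

/-- `(Δ α, α) = ‖∇ α‖² + ‖∇* α‖²`. -/
theorem IsLaplacian.re_l2Inner_nonneg {α χ : TestForm n F E p} (hα : IsLaplacian h conn p α χ) :
    0 ≤ (h.l2Inner χ α).re := by
  have hpos {q : ℕ} (β : TestForm n F E q) : 0 ≤ (h.l2Inner β β).re :=
    (instCore h q).re_inner_nonneg β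
  cases p with
  | zero =>
    obtain ⟨η, h1, h2⟩ := hα
    rw [h2 _ _ h1]
    exact hpos η
  | succ p =>
    obtain ⟨η, θ, χ₁, χ₂, h1, h2, h3, h4, rfl⟩ := hα
    have h5 : conj (h.l2Inner α χ₂) = h.l2Inner χ₂ α :=
      (instCore h (p + 1)).conj_inner_symm χ₂ α
    rw [l2Inner_add_left, h2 _ _ h1, Complex.add_re, ← h5, Complex.conj_re, ← h3 _ _ h4]
    exact add_nonneg (hpos η) (hpos θ)

theorem re_inner_nonneg_of_mem_laplacianL2 {q : L2Form h p × L2Form h p}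
    (hq : q ∈ laplacianL2 h conn p) : 0 ≤ (inner ℂ q.2 q.1).re := by
  have hcl : IsClosed {q : L2Form h p × L2Form h p | 0 ≤ (inner ℂ q.2 q.1).re} :=
    isClosed_le continuous_const
      (Complex.continuous_re.comp (continuous_snd.inner continuous_fst))
  refine closure_minimal ?_ hcl hq
  rintro _ ⟨⟨α, χ⟩, hα, rfl⟩
  have h1 : 0 ≤ (h.l2Inner χ α).re := IsLaplacian.re_l2Inner_nonneg hα
  rw [← inner_toL2] at h1
  exact h1

/-- The heat equation has at most one solution with a given initial value: the norm of the
difference of two solutions does not increase. -/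
theorem IsHeatSemigroup.eq_of_nonneg {S S' : ℝ → L2Form h p →L[ℂ] L2Form h p}
    (hS : IsHeatSemigroup h conn p S) (hS' : IsHeatSemigroup h conn p S') {t : ℝ} (ht : 0 ≤ t) :
    S t = S' t := by
  ext u
  obtain ⟨h0, hc, hd⟩ := hS u
  obtain ⟨h0', hc', hd'⟩ := hS' u
  let w (t : ℝ) := S t u - S' t u
  have hder : ∀ t > 0, ∃ d ≤ 0, HasDerivAt (fun t ↦ ‖w t‖ ^ 2) d t := by
    intro t ht
    obtain ⟨z, hz, hzd⟩ := hd t ht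
    obtain ⟨z', hz', hzd'⟩ := hd' t ht
    have hmem : (w t, z - z') ∈ laplacianL2 h conn p := Submodule.sub_mem _ hz hz'
    have h1 := re_inner_nonneg_of_mem_laplacianL2 hmem
    have h2 : HasDerivAt w (-z - -z') t := hzd.sub hzd'
    have h3 : HasDerivAt (fun t ↦ inner ℂ (w t) (w t)) _ t := h2.inner ℂ h2
    have h4 := Complex.reCLM.hasFDerivAt.comp_hasDerivAt t h3
    refine ⟨_, ?_, h4.congr_of_eventuallyEq (Eventually.of_forall fun s ↦
      (inner_self_eq_norm_sq (𝕜 := ℂ) (w s)).symm)⟩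
    have h5 : -z - -z' = -(z - z') := by abel
    have h6 : (inner ℂ (w t) (z - z')).re = (inner ℂ (z - z') (w t)).re := inner_re_symm (𝕜 := ℂ) _ _
    rw [h5, inner_neg_left, inner_neg_right, Complex.reCLM_apply, Complex.add_re, Complex.neg_re,
      Complex.neg_re, h6]
    simp only at h1
    linarith
  have hanti : AntitoneOn (fun t ↦ ‖w t‖ ^ 2) (Ici 0) := by
    refine antitoneOn_of_deriv_nonpos (convex_Ici 0) ((hc.sub hc').norm.pow 2) ?_ ?_
    · intro t ht
      rw [interior_Ici] at ht
      obtain ⟨d, -, hd⟩ := hder t ht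
      exact hd.differentiableAt.differentiableWithinAt
    · intro t ht
      rw [interior_Ici] at ht
      obtain ⟨d, hd0, hd⟩ := hder t ht
      rwa [hd.deriv]
  have h1 : ‖w t‖ ^ 2 ≤ ‖w 0‖ ^ 2 := hanti self_mem_Ici ht ht
  have h2 : w 0 = 0 := by simp only [w, h0, h0', sub_self]
  rw [h2, norm_zero] at h1
  have h3 : ‖w t‖ = 0 := by nlinarith [norm_nonneg (w t)]
  exact sub_eq_zero.1 (norm_eq_zero.1 h3)

theorem IsHeatSemigroup.heatOp_eq {S : ℝ → L2Form h p →L[ℂ] L2Form h p}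
    (hS : IsHeatSemigroup h conn p S) {t : ℝ} (ht : 0 ≤ t) : heatOp h conn p t = S t := by
  have hex : ∃ S, IsHeatSemigroup h conn p S := ⟨S, hS⟩
  rw [heatOp, dif_pos hex]
  exact hex.choose_spec.eq_of_nonneg hS ht

end Semigroup

variable [FiniteDimensional ℂ F] [ContMDiffVectorBundle ∞ F E (𝓡 n)]
  {h h' : HermitianMetric n F E} {conn : FlatConnection n F E}
  {p : ℕ} {Φ : L2Form h p ≃L[ℂ] L2Form h' p}

theorem map_mem_laplacianL2 (hP : h.IsPreservedBy conn) (hP' : h'.IsPreservedBy conn)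
    (hΦ : ∀ α, Φ (toL2 h p α) = toL2 h' p α) {q : L2Form h p × L2Form h p}
    (hq : q ∈ laplacianL2 h conn p) : (Φ q.1, Φ q.2) ∈ laplacianL2 h' conn p := by
  refine map_mem_closure (f := fun q : L2Form h p × L2Form h p ↦ (Φ q.1, Φ q.2))
    (by fun_prop) hq ?_
  rintro _ ⟨⟨α, χ⟩, hα, rfl⟩
  exact ⟨(α, χ), IsLaplacian.of_preserved hP hP' hα, Prod.ext (hΦ α).symm (hΦ χ).symm⟩

theorem adjoint_mem_laplacianL2 (hP : h.IsPreservedBy conn) (hP' : h'.IsPreservedBy conn)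
    (hΦ : ∀ α, Φ (toL2 h p α) = toL2 h' p α) {q : L2Form h p × L2Form h p}
    (hq : q ∈ laplacianL2 h conn p) :
    ((Φ : L2Form h p →L[ℂ] L2Form h' p).adjoint (Φ q.1),
      (Φ : L2Form h p →L[ℂ] L2Form h' p).adjoint (Φ q.2)) ∈ laplacianL2 h conn p := by
  refine map_mem_closure (f := fun q : L2Form h p × L2Form h p ↦
    ((Φ : L2Form h p →L[ℂ] L2Form h' p).adjoint (Φ q.1),
      (Φ : L2Form h p →L[ℂ] L2Form h' p).adjoint (Φ q.2))) (by fun_prop) hq ?_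
  rintro _ ⟨⟨α, χ⟩, hα, rfl⟩
  have h1 (β : TestForm n F E p) : (Φ : L2Form h p →L[ℂ] L2Form h' p).adjoint (Φ (toL2 h p β)) =
      toL2 h p (h.ratioForm h' β) := by
    rw [hΦ, adjoint_apply_toL2 hΦ]
  exact ⟨(h.ratioForm h' α, h.ratioForm h' χ), IsLaplacian.ratioForm hP hP' hα,
    Prod.ext (h1 α).symm (h1 χ).symm⟩

theorem map_mem_laplacianKer (hP : h.IsPreservedBy conn) (hP' : h'.IsPreservedBy conn)
    (hΦ : ∀ α, Φ (toL2 h p α) = toL2 h' p α) {u : L2Form h p}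
    (hu : u ∈ laplacianKer h conn p) : Φ u ∈ laplacianKer h' conn p := by
  have h1 : (Φ u, Φ 0) ∈ laplacianL2 h' conn p := map_mem_laplacianL2 hP hP' hΦ hu
  rw [map_zero] at h1
  exact h1

theorem kerProj_map_apply (hP : h.IsPreservedBy conn) (hP' : h'.IsPreservedBy conn)
    (hΦ : ∀ α, Φ (toL2 h p α) = toL2 h' p α) (u : L2Form h p) :
    kerProj h' conn p (Φ u) = Φ (kerProj h conn p u) := by
  refine starProjection_map_apply Φ (laplacianKer h conn p) (laplacianKer h' conn p)
    (fun v ↦ ⟨fun hv ↦ ?_, map_mem_laplacianKer hP hP' hΦ⟩) (fun v hv ↦ ?_) u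
  · have h1 := map_mem_laplacianKer hP' hP (symm_apply_toL2 hΦ) hv
    rwa [Φ.symm_apply_apply] at h1
  · have h1 := adjoint_mem_laplacianL2 hP hP' hΦ (show (v, 0) ∈ laplacianL2 h conn p from hv)
    simp only [map_zero] at h1
    exact h1

theorem IsHeatSemigroup.map (hP : h.IsPreservedBy conn) (hP' : h'.IsPreservedBy conn)
    (hΦ : ∀ α, Φ (toL2 h p α) = toL2 h' p α) {S : ℝ → L2Form h p →L[ℂ] L2Form h p}
    (hS : IsHeatSemigroup h conn p S) :
    IsHeatSemigroup h' conn p fun t ↦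
      (Φ : L2Form h p →L[ℂ] L2Form h' p) ∘L S t ∘L (Φ.symm : L2Form h' p →L[ℂ] L2Form h p) := by
  intro u
  obtain ⟨h0, hc, hd⟩ := hS (Φ.symm u)
  refine ⟨?_, Φ.continuous.comp_continuousOn hc, fun t ht ↦ ?_⟩
  · change Φ (S 0 (Φ.symm u)) = u
    rw [h0, Φ.apply_symm_apply]
  · obtain ⟨w, hw, hwd⟩ := hd t ht
    have hmem : (Φ (S t (Φ.symm u)), Φ w) ∈ laplacianL2 h' conn p :=
      map_mem_laplacianL2 hP hP' hΦ hw
    have h1 := hasDerivAt_clm_comp (Φ : L2Form h p →L[ℂ] L2Form h' p) hwd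
    rw [map_neg] at h1
    exact ⟨Φ w, hmem, h1⟩

theorem heatOp_map_apply (hP : h.IsPreservedBy conn) (hP' : h'.IsPreservedBy conn)
    (hΦ : ∀ α, Φ (toL2 h p α) = toL2 h' p α) {t : ℝ} (ht : 0 ≤ t) (u : L2Form h p) :
    heatOp h' conn p t (Φ u) = Φ (heatOp h conn p t u) := by
  by_cases hex : ∃ S, IsHeatSemigroup h conn p S
  · obtain ⟨S, hS⟩ := hex
    rw [hS.heatOp_eq ht, (hS.map hP hP' hΦ).heatOp_eq ht]
    simp
  -- Without a heat semigroup for `h` there is none for `h'`, and both heat operators are `0`.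
  · have hex' : ¬ ∃ S, IsHeatSemigroup h' conn p S := fun ⟨S, hS⟩ ↦
      hex ⟨_, hS.map hP' hP (symm_apply_toL2 hΦ)⟩
    simp [heatOp, dif_neg hex, dif_neg hex']

end LaplacianComparison

/-! ### Equality of the `g`-traces and of the torsion -/

/-- Only the values on `(0, 1]` enter, so the continuations chosen for the two functions agree. -/
theorem isZetaContinuation_congr {T T' : ℝ → ℂ} (hT : ∀ t > 0, T t = T' t) :
    IsZetaContinuation T = IsZetaContinuation T' := by
  have h1 (s : ℂ) : EqOn (fun t : ℝ ↦ (t : ℂ) ^ (s - 1) * T t)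
      (fun t : ℝ ↦ (t : ℂ) ^ (s - 1) * T' t) (Ioc 0 1) := fun t ht ↦ by
    simp only [hT t ht.1]
  funext Z
  simp only [IsZetaContinuation, integrableOn_congr_fun (h1 _) measurableSet_Ioc,
    setIntegral_congr_fun measurableSet_Ioc (h1 _)]

section TorsionComparison

variable {n : ℕ} {M : Type*} [TopologicalSpace M] [ChartedSpace (EuclideanSpace ℝ (Fin n)) M]
  [IsManifold (𝓡 n) ∞ M] [RiemannianBundle (fun m : M ↦ TangentSpace (𝓡 n) m)]
  {F : Type*} [NormedAddCommGroup F] [NormedSpace ℂ F] [FiniteDimensional ℂ F]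
  {E : M → Type*} [∀ m, AddCommGroup (E m)] [∀ m, Module ℂ (E m)]
  [TopologicalSpace (TotalSpace F E)] [∀ m, TopologicalSpace (E m)]
  [FiberBundle F E] [VectorBundle ℝ F E] [VectorBundle ℂ F E] [ContMDiffVectorBundle ∞ F E (𝓡 n)]
  [T2Space M] [SigmaCompactSpace M] [MeasurableSpace M] [BorelSpace M]
  [IsContMDiffRiemannianBundle (𝓡 n) ∞ (EuclideanSpace ℝ (Fin n))
    (fun m : M ↦ TangentSpace (𝓡 n) m)]
  {G : Type*} [Group G] [TopologicalSpace G] [MulAction G M]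

/-- Conjugation by `Φ` does not change the Schwartz kernel: the two sides of the identity
defining the kernel for `h'` are those for `h` with `α` replaced by `A α`. -/
theorem HasKernel.map {h h' : HermitianMetric n F E} {p : ℕ}
    {Φ : L2Form h p ≃L[ℂ] L2Form h' p} (hΦ : ∀ α, Φ (toL2 h p α) = toL2 h' p α)
    {T : L2Form h p →L[ℂ] L2Form h p} {T' : L2Form h' p →L[ℂ] L2Form h' p}
    (hT : ∀ u, T' (Φ u) = Φ (T u)) {κ : FormKernel n E p} (hκ : HasKernel h T κ) :
    HasKernel h' T' κ := by
  intro α β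
  have h1 : inner ℂ (toL2 h' p α) (T' (toL2 h' p β)) =
      inner ℂ (toL2 h p (h.ratioForm h' α)) (T (toL2 h p β)) := by
    rw [← adjoint_apply_toL2 hΦ, ContinuousLinearMap.adjoint_inner_left, ← hΦ β, hT]
    rfl
  rw [h1, hκ]
  simp only [h.formInner_ratioForm_left]

theorem hasKernel_congr {h h' : HermitianMetric n F E} {p : ℕ}
    {Φ : L2Form h p ≃L[ℂ] L2Form h' p} (hΦ : ∀ α, Φ (toL2 h p α) = toL2 h' p α)
    {T : L2Form h p →L[ℂ] L2Form h p} {T' : L2Form h' p →L[ℂ] L2Form h' p}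
    (hT : ∀ u, T' (Φ u) = Φ (T u)) : HasKernel h' T' = HasKernel h T := by
  refine funext fun κ ↦ propext ⟨HasKernel.map (symm_apply_toL2 hΦ) fun u ↦ ?_, HasKernel.map hΦ hT⟩
  rw [← Φ.symm_apply_apply (T (Φ.symm u)), ← hT, Φ.apply_symm_apply]

theorem isGTraceClass_congr {ρ : BundleAction n F E G} {g : G} {ν : Measure (ConjSpace g)}
    {ψ : M → ℝ} {h h' : HermitianMetric n F E} {p : ℕ} {T : L2Form h p →L[ℂ] L2Form h p}
    {T' : L2Form h' p →L[ℂ] L2Form h' p} (hT : HasKernel h' T' = HasKernel h T) :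
    IsGTraceClass ρ g ν ψ h' T' ↔ IsGTraceClass ρ g ν ψ h T := by
  rw [IsGTraceClass, IsGTraceClass, hT]

/-- Operators with the same kernels have the same `g`-trace, even without uniqueness of the
kernel, because the chosen kernel depends only on the set of all kernels. -/
theorem gTrace_congr {ρ : BundleAction n F E G} {g : G} {ν : Measure (ConjSpace g)}
    {ψ : M → ℝ} {h h' : HermitianMetric n F E} {p : ℕ} {T : L2Form h p →L[ℂ] L2Form h p}
    {T' : L2Form h' p →L[ℂ] L2Form h' p} (hT : HasKernel h' T' = HasKernel h T) :
    gTrace ρ g ν ψ h' T' = gTrace ρ g ν ψ h T := by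
  rw [gTrace, gTrace]
  generalize HasKernel h' T' = k at hT
  subst hT
  rfl

variable [∀ m, IsTopologicalAddGroup (E m)] [∀ m, ContinuousSMul ℝ (E m)]

theorem minusTwoLogTorsion_congr {conn : FlatConnection n F E} {ρ : BundleAction n F E G} {g : G}
    {ν : Measure (ConjSpace g)} {ψ : M → ℝ} {h h' : HermitianMetric n F E}
    (hT : ∀ t > 0, curlyT conn ρ g ν ψ h' t = curlyT conn ρ g ν ψ h t) :
    minusTwoLogTorsion conn ρ g ν ψ h' = minusTwoLogTorsion conn ρ g ν ψ h := by
  rw [minusTwoLogTorsion, minusTwoLogTorsion]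
  generalize curlyT conn ρ g ν ψ h' = f' at hT
  generalize curlyT conn ρ g ν ψ h = f at hT
  have hint : ∫ t in Ioi (1 : ℝ), (t : ℂ)⁻¹ * f' t = ∫ t in Ioi (1 : ℝ), (t : ℂ)⁻¹ * f t :=
    setIntegral_congr_fun measurableSet_Ioi fun t ht ↦ by
      simp only [hT t (zero_lt_one.trans ht)]
  rw [hint, isZetaContinuation_congr hT]

/-- The identity of the test forms extends to an isomorphism of the spaces of square-integrable
forms, which intertwines the operators `e^{-tΔ} - P`, so these have the same kernels. -/
theorem hasKernel_heatOp_sub_kerProj [ContinuousConstSMul G M]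
    [CompactSpace (MulAction.orbitRel.Quotient G M)] {ρ : BundleAction n F E G}
    {conn : FlatConnection n F E} {h h' : HermitianMetric n F E}
    (hG : h.IsInvariant ρ) (hP : h.IsPreservedBy conn) (hG' : h'.IsInvariant ρ)
    (hP' : h'.IsPreservedBy conn) (p : ℕ) {t : ℝ} (ht : 0 ≤ t) :
    HasKernel h' (heatOp h' conn p t - kerProj h' conn p) =
      HasKernel h (heatOp h conn p t - kerProj h conn p) := by
  obtain ⟨C, hC0, hC⟩ := HermitianMetric.exists_bound hG hG'
  obtain ⟨C', hC0', hC'⟩ := HermitianMetric.exists_bound hG' hG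
  obtain ⟨Φ, hΦ⟩ := exists_equiv_toL2 hC0 hC hC0' hC' p
  refine hasKernel_congr hΦ fun u ↦ ?_
  rw [sub_apply, sub_apply, map_sub,
    heatOp_map_apply hP hP' hΦ ht, kerProj_map_apply hP hP' hΦ]

end TorsionComparison

end EquivariantTorsion

end

theorem mainTheorem6
    -- `M` is a complete Riemannian manifold (without boundary)
    {n : ℕ} {M : Type*} [EMetricSpace M] [ChartedSpace (EuclideanSpace ℝ (Fin n)) M]
    [IsManifold (𝓡 n) ∞ M] [SigmaCompactSpace M] [MeasurableSpace M] [BorelSpace M]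
    [RiemannianBundle (fun m : M ↦ TangentSpace (𝓡 n) m)]
    [IsContMDiffRiemannianBundle (𝓡 n) ∞ (EuclideanSpace ℝ (Fin n))
      (fun m : M ↦ TangentSpace (𝓡 n) m)]
    [IsRiemannianManifold (𝓡 n) M] [CompleteSpace M]
    -- `G` is a unimodular locally compact group with Haar measure `μ`
    {G : Type*} [Group G] [TopologicalSpace G] [IsTopologicalGroup G] [LocallyCompactSpace G]
    [T2Space G] [MeasurableSpace G] [BorelSpace G]
    (μ : Measure G) [μ.IsHaarMeasure] [μ.IsMulRightInvariant]
    -- `G` acts on `M` properly, cocompactly and by smooth isometries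
    [MulAction G M] [ContinuousSMul G M] [ProperSMul G M]
    [CompactSpace (MulAction.orbitRel.Quotient G M)]
    (_hsmooth : ∀ x : G, ContMDiff (𝓡 n) (𝓡 n) ∞ (fun m : M ↦ x • m))
    (_hisom : ∀ (x : G) (m : M) (v w : TangentSpace (𝓡 n) m),
      inner ℝ (mfderiv (𝓡 n) (𝓡 n) (fun m' : M ↦ x • m') m v)
        (mfderiv (𝓡 n) (𝓡 n) (fun m' : M ↦ x • m') m w) = inner ℝ v w)
    -- `ψ` is a cutoff function, `g ∈ G`, and `ν` is a `G`-invariant measure on `G/Z`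
    (ψ : M → ℝ) (_hψ : EquivariantTorsion.IsCutoff n μ ψ)
    (g : G) (ν : Measure (EquivariantTorsion.ConjSpace g)) [SMulInvariantMeasure G _ ν]
    -- `E` is a complex `G`-vector bundle of finite rank
    {F : Type*} [NormedAddCommGroup F] [NormedSpace ℂ F] [FiniteDimensional ℂ F]
    {E : M → Type*} [∀ m, AddCommGroup (E m)] [∀ m, Module ℂ (E m)]
    [TopologicalSpace (TotalSpace F E)] [∀ m, TopologicalSpace (E m)]
    [∀ m, IsTopologicalAddGroup (E m)] [∀ m, ContinuousSMul ℝ (E m)]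
    [FiberBundle F E] [VectorBundle ℂ F E] [VectorBundle ℝ F E]
    [ContMDiffVectorBundle ∞ F E (𝓡 n)]
    (ρ : EquivariantTorsion.BundleAction n F E G)
    -- `conn` is a `G`-invariant flat connection on `E`
    (conn : EquivariantTorsion.FlatConnection n F E) (_hconn : conn.IsInvariant ρ)
    -- `h` and `h'` are `G`-invariant Hermitian metrics on `E` that are preserved by `conn`
    (h h' : EquivariantTorsion.HermitianMetric n F E)
    (_hG : h.IsInvariant ρ) (_hP : h.IsPreservedBy conn)
    (_hG' : h'.IsInvariant ρ) (_hP' : h'.IsPreservedBy conn) :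
    -- the formal adjoint of `∇` and the Laplacian are the same for `h` and `h'`
    (∀ (p : ℕ) (β : EquivariantTorsion.TestForm n F E (p + 1))
        (γ : EquivariantTorsion.TestForm n F E p),
      EquivariantTorsion.IsFormalAdjoint h conn β γ ↔
        EquivariantTorsion.IsFormalAdjoint h' conn β γ) ∧
    (∀ (p : ℕ) (α χ : EquivariantTorsion.TestForm n F E p),
      EquivariantTorsion.IsLaplacian h conn p α χ ↔
        EquivariantTorsion.IsLaplacian h' conn p α χ) ∧
    -- if torsion is defined for `h`, then it is defined for `h'`, with the same value
    (EquivariantTorsion.TorsionConditions conn ρ g ν ψ h →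
      EquivariantTorsion.TorsionConditions conn ρ g ν ψ h' ∧
      EquivariantTorsion.minusTwoLogTorsion conn ρ g ν ψ h' =
        EquivariantTorsion.minusTwoLogTorsion conn ρ g ν ψ h ∧
      EquivariantTorsion.analyticTorsion conn ρ g ν ψ h' =
        EquivariantTorsion.analyticTorsion conn ρ g ν ψ h) := by
  have hker (p : ℕ) (t : ℝ) (ht : 0 < t) :=
    EquivariantTorsion.hasKernel_heatOp_sub_kerProj _hG _hP _hG' _hP' p ht.le
  have htrace : ∀ t > 0, EquivariantTorsion.curlyT conn ρ g ν ψ h' t =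
      EquivariantTorsion.curlyT conn ρ g ν ψ h t := fun t ht ↦
    Finset.sum_congr rfl fun p _ ↦
      congrArg (((-1 : ℂ) ^ p * p) * ·) (EquivariantTorsion.gTrace_congr (hker p t ht))
  have hlog := EquivariantTorsion.minusTwoLogTorsion_congr htrace
  refine ⟨fun p β γ ↦ ⟨fun hβ ↦ hβ.of_preserved _hP _hP', fun hβ ↦ hβ.of_preserved _hP' _hP⟩,
    fun p α χ ↦ ⟨fun hα ↦ hα.of_preserved _hP _hP', fun hα ↦ hα.of_preserved _hP' _hP⟩,
    fun hT ↦ ⟨⟨fun t ht p ↦ ?_, ?_, ?_⟩, hlog, ?_⟩⟩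
  · exact (EquivariantTorsion.isGTraceClass_congr (hker p t ht)).2 (hT.traceClass t ht p)
  · obtain ⟨a, ha, hO⟩ := hT.decay
    refine ⟨a, ha, hO.congr' ?_ EventuallyEq.rfl⟩
    filter_upwards [eventually_gt_atTop 0] with t ht
    exact (htrace t ht).symm
  · rw [EquivariantTorsion.isZetaContinuation_congr htrace]
    exact hT.continuation
  · rw [EquivariantTorsion.analyticTorsion, EquivariantTorsion.analyticTorsion, hlog]
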